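/- Let $N,l$ be non-negative integers with $N+l\ge 3$ and let $\gamma\ge 0$ be real. Write points of $\mathbb R^{N+l}=\mathbb R^N\times\mathbb R^l$ as $z=(x,y)$, and put $\nabla_\gamma u=(\nabla_x u,|x|^\gamma\nabla_y u)$, $\Delta_\gamma u=\Delta_x u+|x|^{2\gamma}\Delta_y u$ and $b=\frac{2(N+l)}{N+l-2}$. Let $\Omega\subset\mathbb R^{N+l}$ be a bounded domain with Lipschitz boundary, and let $\nu=(\nu_x,\nu_y)$ be its unit outward normal, which exists at almost every point of $\partial\Omega$. Suppose that $\Omega$ is $L$-starshaped with respect to the origin, that is, $$\left(|\nu_x|^2+|x|^{2\gamma}|\nu_y|^2\right)\left(x\cdot\nu_x+y\cdot\nu_y\right)>0\quad\text{for almost every } z=(x,y)\in\partial\Omega$$ with respect to the $(N+l-1)$-dimensional Hausdorff measure. Then the problem $$-\Delta_\gamma u=u^{b-1},\quad u>0\quad\text{in }\Omega,\qquad u=0\quad\text{on }\partial\Omega,$$ has no solution $u\in C^1(\overline\Omega)$ whose normal derivative satisfies $\frac{\partial u}{\partial\nu}\not\equiv0$ on $\partial\Omega$ (i.e. $\frac{\partial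 u}{\partial\nu}(z)\ne0$ for at least one $z\in\partial\Omega$ at which $\nu$ exists; in particular, there is none with $\frac{\partial u}{\partial\nu}\neq0$ everywhere or almost everywhere on $\partial\Omega$). Here the equation is understood in the weak sense: $\int_\Omega\nabla_\gamma u\cdot\nabla_\gamma\varphi\,dz=\int_\Omega u^{b-1}\varphi\,dz$ for all $\varphi\in C_c^\infty(\Omega)$. In particular there is no such classical solution $u\in C^2(\Omega)\cap C^1(\overline\Omega)$. -/

import Mathlib

open MeasureTheory Topology
open scoped ContDiff InnerProductSpace

noncomputable section

/-- The Euclidean space `ℝ^N × ℝ^l = ℝ^(N+l)`, with points `z = (x, y)`. -/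
abbrev GSpace (N l : ℕ) : Type := EuclideanSpace ℝ (Fin N ⊕ Fin l)

/-- The component `x ∈ ℝ^N` of `z = (x, y)`. -/
def xPart {N l : ℕ} (z : GSpace N l) : EuclideanSpace ℝ (Fin N) :=
  WithLp.toLp 2 fun i => z (Sum.inl i)

/-- The component `y ∈ ℝ^l` of `z = (x, y)`. -/
def yPart {N l : ℕ} (z : GSpace N l) : EuclideanSpace ℝ (Fin l) :=
  WithLp.toLp 2 fun j => z (Sum.inr j)

/-- The Grushin gradient `∇_γ u = (∇_x u, |x|^γ ∇_y u)`. -/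
def grushinGradient {N l : ℕ} (γ : ℝ) (u : GSpace N l → ℝ) (z : GSpace N l) : GSpace N l :=
  WithLp.toLp 2 (Sum.elim (fun i => gradient u z (Sum.inl i))
    (fun j => ‖xPart z‖ ^ γ * gradient u z (Sum.inr j)))

/-- `Ω` has a Lipschitz boundary: near every boundary point there are a unit vector `e` and a
Lipschitz function `g` such that `Ω` is the part lying strictly below the graph of `g` over the
hyperplane orthogonal to `e`. Only the values of `g` on that hyperplane are used. -/
def HasLipschitzBoundary {N l : ℕ} (Ω : Set (GSpace N l)) : Prop :=
  ∀ z₀ ∈ frontier Ω, ∃ (e : GSpace N l) (K : NNReal) (g : GSpace N l → ℝ),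
    ‖e‖ = 1 ∧ LipschitzWith K g ∧
      ∀ᶠ w in 𝓝 z₀, (w ∈ Ω ↔ ⟪w, e⟫_ℝ < g (w - ⟪w, e⟫_ℝ • e))

/-- `ν` is the unit outward normal of `Ω` at its boundary point `z`: up to an error `o(|w - z|)`,
near `z` the set `Ω` is the half-space `(w - z) · ν < 0`. There is at most one such `ν`; at a point
near which `Ω` is `{ρ < 0}` with `ρ` of class `C^1` and `∇ρ(z) ≠ 0` it is `∇ρ(z) / |∇ρ(z)|`, and
where `Ω` lies below the graph of a Lipschitz function it exists wherever that function is
differentiable. -/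
def IsOutwardUnitNormal {N l : ℕ} (Ω : Set (GSpace N l)) (z ν : GSpace N l) : Prop :=
  ‖ν‖ = 1 ∧ ∀ ε > (0 : ℝ), ∀ᶠ w in 𝓝 z,
    (w ∈ Ω → ⟪w - z, ν⟫_ℝ ≤ ε * ‖w - z‖) ∧ (w ∉ Ω → -(ε * ‖w - z‖) ≤ ⟪w - z, ν⟫_ℝ)

/-- `Ω` is `L`-starshaped with respect to the origin:
`(ν_x² + |x|^(2γ) ν_y²) (x · ν_x + y · ν_y) > 0` almost everywhere on `∂Ω` for the surface measure,
that is, the `(N + l - 1)`-dimensional Hausdorff measure. -/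
def IsLStarshaped {N l : ℕ} (γ : ℝ) (Ω : Set (GSpace N l)) : Prop :=
  ∀ᵐ z ∂((Measure.hausdorffMeasure ((N : ℝ) + l - 1)).restrict (frontier Ω)),
    ∃ ν : GSpace N l, IsOutwardUnitNormal Ω z ν ∧
      0 < (‖xPart ν‖ ^ 2 + ‖xPart z‖ ^ (2 * γ) * ‖yPart ν‖ ^ 2) *
        (⟪xPart z, xPart ν⟫_ℝ + ⟪yPart z, yPart ν⟫_ℝ)

/-- `u` is a positive (weak) solution, of class `C^1` up to the boundary, of
`-Δ_γ u = u^(b-1)`, `u > 0` in `Ω`, `u = 0` on `∂Ω`. For bounded `Ω` such a `u` lies in the weighted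
space `H^{1,2}_γ(Ω)`. The equation is tested against `φ ∈ C_c^∞(Ω)`, so that every classical solution
`u ∈ C^2(Ω) ∩ C^1(closure Ω)` is included. -/
structure IsPositiveSolution {N l : ℕ} (γ b : ℝ) (Ω : Set (GSpace N l))
    (u : GSpace N l → ℝ) : Prop where
  contDiffOn : ContDiffOn ℝ 1 u (closure Ω)
  pos : ∀ z ∈ Ω, 0 < u z
  boundary : ∀ z ∈ frontier Ω, u z = 0
  weak_eq : ∀ φ : GSpace N l → ℝ, ContDiff ℝ ∞ φ → HasCompactSupport φ → tsupport φ ⊆ Ω →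
    ∫ z in Ω, ⟪grushinGradient γ u z, grushinGradient γ φ z⟫_ℝ = ∫ z in Ω, u z ^ (b - 1) * φ z

/-- The derivative `∂u/∂ν` at a boundary point `z`, for `u` of class `C^1` up to the boundary. -/
def normalDeriv {N l : ℕ} (Ω : Set (GSpace N l)) (u : GSpace N l → ℝ) (z ν : GSpace N l) : ℝ :=
  fderivWithin ℝ u (closure Ω) z ν

end

/-! The solution, extended by zero to `v`, is compared with its isotropic dilations `v_c(z) = v(c
z)`, `c > 1`. This is a form of Pohozaev's argument that needs neither second derivatives nor
boundary integrals.

The sign condition on the normal holds only almost everywhere, but it makes `Ω` starshaped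
(`IsLStarshaped.smul_mem`): in a graph chart it says that `g (t p) / t` does not increase to the
right along almost every ray, and the Lipschitz property of `g` integrates this. Hence `v_c`
vanishes off `Ω` and is an admissible test function (`IsZeroExtension.weak_eq_smul`).

Put `n = N + l`, and let `X`, `Y` be the energies in `x` and in `y`, so that `X + Y = ∫ v^b`. In the
energy `E` of `v - v_c`, the part of `v_c` is `c^(2-n) X + c^(2-n-2γ) Y`. The cross term is `∫
v^(b-1) v_c`, which by Taylor's formula is at least `∫ (v_c^b / b + (1 - 1/b) v^b) - O((c-1)²)`,
with `∫ v_c^b = c^(-n) (X + Y)`. Since `2n/b = n - 2`, the first order terms cancel except for one: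
`0 ≤ E ≤ -2γY (c-1) + o(c-1)`. So `γ Y = 0` and `E = o(c-1)` (`IsZeroExtension.pohozaev`).

If `γ > 0` and `l > 0`, then `Y = 0`. For `N > 0` the solution does not depend on `y`, impossible in
a bounded domain; for `N = 0` its whole energy vanishes, although it is positive.

Otherwise `E` is the Dirichlet energy. If the gradient is nonzero at a boundary point, it is bounded
below nearby; on the layer of points that the dilation by `c` pushes out of `Ω` the gradient of
`v_c` is zero, so this layer has volume `o(c-1)` (`IsZeroExtension.volume_leave_le`). Iterating
small dilations, no point near there leaves the closure of `Ω` at all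
(`exists_nhds_smul_mem_closure`). But starshapedness gives boundary points arbitrarily near whose
rays leave the closure at once. -/

noncomputable section

open Set Filter Metric

/-! ### Monotonicity along rays from almost-everywhere information -/

/-- An absolutely continuous function which almost everywhere does not increase to the right
does not increase. -/
theorem AbsolutelyContinuousOnInterval.le_of_ae_eventually_le {q : ℝ → ℝ} {a b : ℝ} (hab : a ≤ b)
    (hq : AbsolutelyContinuousOnInterval q a b)
    (h : ∀ᵐ t : ℝ, t ∈ Ioo a b → ∀ᶠ s in 𝓝[>] t, q s ≤ q t) : q b ≤ q a := by
  -- Where `q` is not differentiable, `deriv q t` has the default value 0, so the sign holds there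
  -- too.
  have key : ∀ t, (∀ᶠ s in 𝓝[>] t, q s ≤ q t) → deriv q t ≤ 0 := by
    intro t ht
    by_cases hd : DifferentiableAt ℝ q t
    · have h1 := (hasDerivAt_iff_tendsto_slope.1 hd.hasDerivAt).mono_left
        (nhdsWithin_mono t (fun s hs => (ne_of_gt (mem_Ioi.1 hs)) : Ioi t ⊆ {t}ᶜ))
      refine le_of_tendsto h1 ?_
      filter_upwards [ht, self_mem_nhdsWithin] with s hs hts
      rw [slope_def_field]
      exact div_nonpos_of_nonpos_of_nonneg (by linarith) (sub_nonneg.2 (le_of_lt hts))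
    · rw [deriv_zero_of_not_differentiableAt hd]
  have h2 := hq.integral_deriv_eq_sub
  have h3 : ∫ t in a..b, deriv q t ≤ 0 := by
    rw [intervalIntegral.integral_of_le hab, integral_Ioc_eq_integral_Ioo]
    refine setIntegral_nonpos_of_ae_restrict ?_
    rw [EventuallyLE, ae_restrict_iff' measurableSet_Ioo]
    filter_upwards [h] with t ht hmem using key t (ht hmem)
  linarith

section Rays

variable {V : Type*} [NormedAddCommGroup V] [NormedSpace ℝ V] [FiniteDimensional ℝ V]
  [MeasurableSpace V] [BorelSpace V]

/-- A property that holds almost everywhere holds almost everywhere along almost every ray. -/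
theorem ae_ae_smul_of_ae (μ : Measure V) [μ.IsAddHaarMeasure] {P : V → Prop}
    (hP : ∀ᵐ p ∂μ, P p) : ∀ᵐ p ∂μ, ∀ᵐ t : ℝ, t ≠ 0 → P (t • p) := by
  obtain ⟨B, hB, hBm, hB0⟩ := exists_measurable_superset_of_null (ae_iff.1 hP)
  have hm : Measurable fun x : V × ℝ => x.2 • x.1 := (continuous_snd.smul continuous_fst).measurable
  let S : Set (V × ℝ) := {x | x.2 ≠ 0 ∧ x.2 • x.1 ∈ B}
  have hS : MeasurableSet S :=
    (measurable_snd (measurableSet_singleton (0 : ℝ)).compl).inter (hm hBm)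
  -- Fubini: for fixed `t ≠ 0` the slice is the preimage of a null set under a dilation, hence null.
  have h0 : (μ.prod (volume : Measure ℝ)) S = 0 := by
    rw [Measure.prod_apply_symm hS]
    refine (lintegral_congr fun t => ?_).trans lintegral_zero
    by_cases ht : t = 0
    · simp [S, ht]
    · have : (fun x : V => (x, t)) ⁻¹' S = (t • ·) ⁻¹' B := by ext x; simp [S, ht]
      rw [this, Measure.addHaar_preimage_smul μ ht, hB0, mul_zero]
  have h1 := Measure.ae_ae_of_ae_prod (p := fun x => x ∉ S) (μ := μ) (ν := volume)
    (by rw [ae_iff]; simpa using h0)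
  filter_upwards [h1] with p hp
  filter_upwards [hp] with t ht ht0
  by_contra hc
  exact ht ⟨ht0, hB hc⟩

/-- If `G (τ p) ≤ τ G p` for `τ > 1` close to `1`, for almost every `p`, then `G (t p) / t`
does not increase with `t`. -/
theorem LipschitzWith.div_le_div_of_ae_ray (μ : Measure V) [μ.IsAddHaarMeasure] {G : V → ℝ}
    {K : NNReal} (hG : LipschitzWith K G) {U : Set V} (hUo : IsOpen U) (hUc : Convex ℝ U)
    (hgood : ∀ᵐ p ∂μ, p ∈ U → ∀ᶠ τ in 𝓝[>] (1 : ℝ), G (τ • p) ≤ τ * G p)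
    {p : V} {a b : ℝ} (ha : 0 < a) (hab : a ≤ b) (hpa : a • p ∈ U) (hpb : b • p ∈ U) :
    G (b • p) / b ≤ G (a • p) / a := by
  have hc : ∀ c : ℝ, Continuous fun v : V => c • v := fun c => continuous_const_smul c
  let O : Set V := (a • ·) ⁻¹' U ∩ (b • ·) ⁻¹' U
  have hO : IsOpen O := (hUo.preimage (hc a)).inter (hUo.preimage (hc b))
  -- Both sides are continuous in the point, so it is enough to treat a dense set of directions near
  -- `p`. For those, convexity of `U` keeps the whole segment from `a • v` to `b • v` in `U`.
  have hd := Measure.dense_of_ae (ae_ae_smul_of_ae μ hgood)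
  have hcl : IsClosed {v : V | G (b • v) / b ≤ G (a • v) / a} :=
    isClosed_le ((hG.continuous.comp (hc b)).div_const b) ((hG.continuous.comp (hc a)).div_const a)
  refine (closure_minimal ?_ hcl) (hd.open_subset_closure_inter hO ⟨hpa, hpb⟩)
  rintro v ⟨⟨hva, hvb⟩, hv⟩
  have hac : AbsolutelyContinuousOnInterval (fun t : ℝ => G (t • v) * t⁻¹) a b := by
    have h1 : AbsolutelyContinuousOnInterval (fun t : ℝ => G (t • v)) a b := by
      have : LipschitzWith (K * ‖v‖₊) fun t : ℝ => G (t • v) :=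
        hG.comp (LipschitzWith.of_dist_le_mul fun s t => by
          rw [dist_eq_norm, ← sub_smul, norm_smul, mul_comm, dist_eq_norm]; rfl)
      exact this.lipschitzOnWith.absolutelyContinuousOnInterval
    have h2 : AbsolutelyContinuousOnInterval (fun t : ℝ => t⁻¹) a b := by
      refine ContDiffOn.absolutelyContinuousOnInterval fun t ht => ?_
      rw [uIcc_of_le hab] at ht
      exact (contDiffAt_inv ℝ (ha.trans_le ht.1).ne').contDiffWithinAt
    exact h1.mul h2
  have := hac.le_of_ae_eventually_le hab ?_
  · simpa [div_eq_mul_inv] using this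
  filter_upwards [hv] with t ht htab
  have ht0 : 0 < t := ha.trans htab.1
  have htU : t • v ∈ U := by
    have hba : 0 < b - a := by linarith [htab.1, htab.2]
    have := hUc hva hvb (a := (b - t) / (b - a)) (b := (t - a) / (b - a))
      (div_nonneg (by linarith [htab.2]) hba.le) (div_nonneg (by linarith [htab.1]) hba.le)
      (by field_simp; ring)
    convert this using 1
    rw [smul_smul, smul_smul, ← add_smul]
    congr 1
    field_simp
    ring
  have h1 := ht ht0.ne' htU
  have h2 : Tendsto (fun s : ℝ => s / t) (𝓝[>] t) (𝓝[>] 1) := by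
    refine tendsto_nhdsWithin_iff.2 ⟨?_, ?_⟩
    · have : Tendsto (fun s : ℝ => s / t) (𝓝 t) (𝓝 (t / t)) :=
        (continuous_id.div_const t).tendsto t
      rw [div_self ht0.ne'] at this
      exact this.mono_left nhdsWithin_le_nhds
    · filter_upwards [self_mem_nhdsWithin] with s hs
      exact (one_lt_div ht0).2 hs
  filter_upwards [h2.eventually h1, self_mem_nhdsWithin] with s hs hts
  have hs0 : 0 < s := ht0.trans hts
  rw [smul_smul, div_mul_cancel₀ _ ht0.ne'] at hs
  rw [← div_eq_mul_inv, ← div_eq_mul_inv, div_le_iff₀ hs0]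
  refine hs.trans (le_of_eq ?_)
  field_simp

end Rays

/-! ### Normals, graph charts and starshapedness -/

theorem inner_xPart_add_inner_yPart {N l : ℕ} (z w : GSpace N l) :
    ⟪xPart z, xPart w⟫_ℝ + ⟪yPart z, yPart w⟫_ℝ = ⟪z, w⟫_ℝ := by
  simp [xPart, yPart, PiLp.inner_apply, Fintype.sum_sum_type]

/-- The ray through a boundary point with `z · ν > 0` leaves the domain there. -/
theorem IsOutwardUnitNormal.eventually_smul_notMem_closure {N l : ℕ} {Ω : Set (GSpace N l)}
    {z ν : GSpace N l} (hν : IsOutwardUnitNormal Ω z ν) (h : 0 < ⟪z, ν⟫_ℝ) :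
    ∀ᶠ τ in 𝓝[>] (1 : ℝ), τ • z ∉ closure Ω := by
  have hz : 0 < ‖z‖ := norm_pos_iff.2 fun h0 => by simp [h0] at h
  -- With this `ε`, a point `τ • z` of the closure would satisfy `(τ - 1) ⟪z, ν⟫ ≤ (τ - 1) ⟪z, ν⟫ /
  -- 2`.
  have hε : 0 < ⟪z, ν⟫_ℝ / (2 * ‖z‖) := by positivity
  obtain ⟨O, hO, hOo, hzO⟩ := _root_.eventually_nhds_iff.1 (hν.2 _ hε)
  have ht : Tendsto (fun τ : ℝ => τ • z) (𝓝[>] 1) (𝓝 z) := by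
    have : Tendsto (fun τ : ℝ => τ • z) (𝓝 1) (𝓝 ((1 : ℝ) • z)) :=
      (continuous_id.smul continuous_const).tendsto 1
    rw [one_smul] at this
    exact this.mono_left nhdsWithin_le_nhds
  filter_upwards [ht.eventually (hOo.mem_nhds hzO), self_mem_nhdsWithin] with τ hτ hτ1 hcl
  have hτ0 : 0 < τ - 1 := sub_pos.2 hτ1
  have hclosed : IsClosed {w : GSpace N l |
      ⟪w - z, ν⟫_ℝ ≤ ⟪z, ν⟫_ℝ / (2 * ‖z‖) * ‖w - z‖} := by
    refine isClosed_le ?_ ?_ <;> fun_prop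
  have h1 : τ • z ∈ closure (O ∩ Ω) := hOo.inter_closure ⟨hτ, hcl⟩
  have h2 := closure_minimal (fun w hw => (hO w hw.1).1 hw.2) hclosed h1
  have h3 : τ • z - z = (τ - 1) • z := by rw [sub_smul, one_smul]
  replace h2 : ⟪τ • z - z, ν⟫_ℝ ≤ ⟪z, ν⟫_ℝ / (2 * ‖z‖) * ‖τ • z - z‖ := h2
  rw [h3, real_inner_smul_left, norm_smul, Real.norm_eq_abs, abs_of_pos hτ0] at h2
  have h4 : ⟪z, ν⟫_ℝ / (2 * ‖z‖) * ((τ - 1) * ‖z‖) = (τ - 1) * ⟪z, ν⟫_ℝ / 2 := by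
    field_simp
  rw [h4] at h2
  have : 0 < (τ - 1) * ⟪z, ν⟫_ℝ := mul_pos hτ0 h
  linarith

section Charts

variable {N l : ℕ}

/-- The set `Ω` is, inside `W`, the part strictly below the graph of `g` over `e^⊥`. -/
structure IsGraphChart (Ω W : Set (GSpace N l)) (e : GSpace N l) (K : NNReal)
    (g : GSpace N l → ℝ) : Prop where
  norm_eq : ‖e‖ = 1
  lipschitz : LipschitzWith K g
  isOpen : IsOpen W
  mem_iff : ∀ w ∈ W, (w ∈ Ω ↔ ⟪w, e⟫_ℝ < g (w - ⟪w, e⟫_ℝ • e))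

theorem HasLipschitzBoundary.exists_isGraphChart {Ω : Set (GSpace N l)}
    (h : HasLipschitzBoundary Ω) {z : GSpace N l} (hz : z ∈ frontier Ω) :
    ∃ W e K g, z ∈ W ∧ IsGraphChart Ω W e K g := by
  obtain ⟨e, K, g, he, hg, hev⟩ := h z hz
  obtain ⟨W, hW, hWo, hzW⟩ := _root_.eventually_nhds_iff.1 hev
  exact ⟨W, e, K, g, hzW, he, hg, hWo, hW⟩

/-- The orthogonal projection to `e^⊥`. -/
def projHyperplane (e : GSpace N l) (he : ‖e‖ = 1) (w : GSpace N l) : (ℝ ∙ e)ᗮ :=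
  ⟨w - ⟪w, e⟫_ℝ • e, by
    rw [Submodule.mem_orthogonal_singleton_iff_inner_right, inner_sub_right, inner_smul_right,
      real_inner_self_eq_norm_sq, he, real_inner_comm]
    simp⟩

/-- The point of the graph of `g` above `p`. -/
def graphPoint (e : GSpace N l) (g : GSpace N l → ℝ) (p : (ℝ ∙ e)ᗮ) : GSpace N l :=
  (p : GSpace N l) + g p • e

theorem inner_coe_add_smul {e : GSpace N l} (he : ‖e‖ = 1) (p : (ℝ ∙ e)ᗮ) (c : ℝ) :
    ⟪(p : GSpace N l) + c • e, e⟫_ℝ = c := by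
  have := (Submodule.mem_orthogonal_singleton_iff_inner_left (𝕜 := ℝ)).1 p.2
  rw [inner_add_left, this, inner_smul_left, real_inner_self_eq_norm_sq, he]
  simp

theorem projHyperplane_coe_add_smul {e : GSpace N l} (he : ‖e‖ = 1) (p : (ℝ ∙ e)ᗮ) (c : ℝ) :
    projHyperplane e he ((p : GSpace N l) + c • e) = p := by
  apply Subtype.ext
  simp only [projHyperplane]
  rw [inner_coe_add_smul he, add_sub_cancel_right]

theorem coe_projHyperplane_add {e : GSpace N l} (he : ‖e‖ = 1) (w : GSpace N l) :
    (projHyperplane e he w : GSpace N l) + ⟪w, e⟫_ℝ • e = w := by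
  simp [projHyperplane]

theorem projHyperplane_smul {e : GSpace N l} (he : ‖e‖ = 1) (t : ℝ) (w : GSpace N l) :
    projHyperplane e he (t • w) = t • projHyperplane e he w := by
  apply Subtype.ext
  simp [projHyperplane, inner_smul_left, smul_sub, smul_smul]

theorem continuous_projHyperplane {e : GSpace N l} (he : ‖e‖ = 1) :
    Continuous (projHyperplane e he) :=
  Continuous.subtype_mk (by fun_prop) _

theorem lipschitzWith_projHyperplane {e : GSpace N l} (he : ‖e‖ = 1) :
    LipschitzWith 2 (projHyperplane e he) := by
  refine LipschitzWith.of_dist_le_mul fun v w => ?_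
  rw [Subtype.dist_eq, dist_eq_norm, dist_eq_norm]
  have : (projHyperplane e he v : GSpace N l) - projHyperplane e he w
      = (v - w) - ⟪v - w, e⟫_ℝ • e := by
    simp only [projHyperplane, inner_sub_left, sub_smul]; abel
  rw [this]
  have h1 : ‖⟪v - w, e⟫_ℝ • e‖ ≤ ‖v - w‖ := by
    rw [norm_smul, he, mul_one]
    simpa [he] using norm_inner_le_norm (𝕜 := ℝ) (v - w) e
  calc _ ≤ ‖v - w‖ + ‖⟪v - w, e⟫_ℝ • e‖ := norm_sub_le _ _
    _ ≤ 2 * ‖v - w‖ := by linarith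

namespace IsGraphChart

variable {Ω W : Set (GSpace N l)} {e : GSpace N l} {K : NNReal} {g : GSpace N l → ℝ}

theorem continuous_height (h : IsGraphChart Ω W e K g) :
    Continuous fun w : GSpace N l => g (w - ⟪w, e⟫_ℝ • e) :=
  h.lipschitz.continuous.comp (by fun_prop)

theorem inner_eq (h : IsGraphChart Ω W e K g) {z : GSpace N l} (hzW : z ∈ W)
    (hz : z ∈ frontier Ω) : ⟪z, e⟫_ℝ = g (z - ⟪z, e⟫_ℝ • e) := by
  have hi : Continuous fun w : GSpace N l => ⟪w, e⟫_ℝ := by fun_prop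
  refine le_antisymm ?_ ?_
  · by_contra! hlt
    have hev : ∀ᶠ w in 𝓝 z, w ∉ Ω := by
      filter_upwards [h.isOpen.mem_nhds hzW,
        (isOpen_lt h.continuous_height hi).mem_nhds hlt] with w hw hlt' hwΩ
      exact lt_asymm hlt' ((h.mem_iff w hw).1 hwΩ)
    exact (mem_closure_iff_frequently.1 hz.1) hev
  · by_contra! hlt
    refine hz.2 (mem_interior_iff_mem_nhds.2 ?_)
    filter_upwards [h.isOpen.mem_nhds hzW,
      (isOpen_lt hi h.continuous_height).mem_nhds hlt] with w hw hlt'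
    exact (h.mem_iff w hw).2 hlt'

theorem graphPoint_projHyperplane (h : IsGraphChart Ω W e K g) {z : GSpace N l} (hzW : z ∈ W)
    (hz : z ∈ frontier Ω) : graphPoint e g (projHyperplane e h.norm_eq z) = z := by
  have := h.inner_eq hzW hz
  conv_rhs => rw [← coe_projHyperplane_add h.norm_eq z, this]
  rfl

theorem continuous_graphPoint (h : IsGraphChart Ω W e K g) : Continuous (graphPoint e g) :=
  continuous_subtype_val.add
    ((h.lipschitz.continuous.comp continuous_subtype_val).smul continuous_const)

theorem mem_iff_lt (h : IsGraphChart Ω W e K g) {p : (ℝ ∙ e)ᗮ} {c : ℝ}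
    (hp : (p : GSpace N l) + c • e ∈ W) : (p : GSpace N l) + c • e ∈ Ω ↔ c < g p := by
  rw [h.mem_iff _ hp, inner_coe_add_smul h.norm_eq, add_sub_cancel_right]

theorem graphPoint_mem_frontier (h : IsGraphChart Ω W e K g) {p : (ℝ ∙ e)ᗮ}
    (hp : graphPoint e g p ∈ W) : graphPoint e g p ∈ frontier Ω := by
  refine ⟨?_, fun hi => ?_⟩
  · have ht : Tendsto (fun c : ℝ => (p : GSpace N l) + c • e) (𝓝[<] (g p))
        (𝓝 (graphPoint e g p)) :=
      ((show Continuous fun c : ℝ => (p : GSpace N l) + c • e by fun_prop).tendsto (g p)).mono_left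
        nhdsWithin_le_nhds
    refine mem_closure_of_tendsto ht ?_
    filter_upwards [ht.eventually (h.isOpen.mem_nhds hp), self_mem_nhdsWithin] with c hc hlt
    exact (h.mem_iff_lt hc).2 hlt
  · exact lt_irrefl _ ((h.mem_iff_lt hp).1 (interior_subset hi))

/-- The projection to the hyperplane is Lipschitz and inverts `graphPoint`, so it carries null sets
of the boundary to null sets. The exponent is written as a `finrank` because that Hausdorff measure
is a Haar measure on the hyperplane. -/
theorem ae_hyperplane (h : IsGraphChart Ω W e K g) {Q : GSpace N l → Prop}
    (hQ : ∀ᵐ z ∂((Measure.hausdorffMeasure ((N : ℝ) + l - 1)).restrict (frontier Ω)), Q z) :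
    ∀ᵐ p : (ℝ ∙ e)ᗮ ∂(Measure.hausdorffMeasure (Module.finrank ℝ (ℝ ∙ e)ᗮ)),
      graphPoint e g p ∈ W → Q (graphPoint e g p) := by
  have hdim : ((Module.finrank ℝ (ℝ ∙ e)ᗮ : ℕ) : ℝ) = (N : ℝ) + l - 1 := by
    have h0 : e ≠ 0 := fun h0 => by simpa [h0] using h.norm_eq
    have h1 := Submodule.finrank_add_finrank_orthogonal (ℝ ∙ e)
    rw [finrank_span_singleton h0, finrank_euclideanSpace, Fintype.card_sum, Fintype.card_fin,
      Fintype.card_fin] at h1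
    have : ((1 + Module.finrank ℝ (ℝ ∙ e)ᗮ : ℕ) : ℝ) = ((N + l : ℕ) : ℝ) := by rw [h1]
    push_cast at this
    linarith
  rw [ae_restrict_iff' isClosed_frontier.measurableSet, ae_iff] at hQ
  rw [ae_iff, hdim]
  have hd : 0 ≤ (N : ℝ) + l - 1 := by rw [← hdim]; positivity
  refine measure_mono_null (fun p hp => ?_) (nonpos_iff_eq_zero.1
    (((lipschitzWith_projHyperplane h.norm_eq).hausdorffMeasure_image_le hd _).trans
      (by rw [hQ, mul_zero])))
  simp only [mem_ofPred_eq, Classical.not_imp] at hp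
  exact ⟨graphPoint e g p, fun hc => hp.2 (hc (h.graphPoint_mem_frontier hp.1)),
    projHyperplane_coe_add_smul h.norm_eq p _⟩

end IsGraphChart

/-- All later uses of the starshapedness hypothesis come from this consequence. The weighted factor
is nonnegative, so a positive product forces `0 < ⟪z, ν⟫`. -/
theorem IsLStarshaped.ae_eventually_smul_notMem_closure {γ : ℝ} {Ω : Set (GSpace N l)}
    (h : IsLStarshaped γ Ω) :
    ∀ᵐ z ∂((Measure.hausdorffMeasure ((N : ℝ) + l - 1)).restrict (frontier Ω)),
      ∀ᶠ τ in 𝓝[>] (1 : ℝ), τ • z ∉ closure Ω := by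
  filter_upwards [h] with z hz
  obtain ⟨ν, hν, hpos⟩ := hz
  refine hν.eventually_smul_notMem_closure ?_
  rw [← inner_xPart_add_inner_yPart]
  exact (pos_iff_pos_of_mul_pos hpos).1 (lt_of_le_of_ne (by positivity) fun h0 => by
    rw [← h0, zero_mul] at hpos; exact lt_irrefl _ hpos)

/-- Every part of the boundary of an `L`-starshaped domain has points where the ray from the
origin leaves the closure. -/
theorem exists_mem_frontier_eventually_smul_notMem_closure {γ : ℝ} {Ω : Set (GSpace N l)}
    (hlip : HasLipschitzBoundary Ω) (hstar : IsLStarshaped γ Ω) {z : GSpace N l}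
    (hz : z ∈ frontier Ω) {O : Set (GSpace N l)} (hO : O ∈ 𝓝 z) :
    ∃ w ∈ frontier Ω ∩ O, ∀ᶠ τ in 𝓝[>] (1 : ℝ), τ • w ∉ closure Ω := by
  obtain ⟨W, e, K, g, hzW, h⟩ := hlip.exists_isGraphChart hz
  have hd := Measure.dense_of_ae (h.ae_hyperplane hstar.ae_eventually_smul_notMem_closure)
  have hz' := h.graphPoint_projHyperplane hzW hz
  have hn : graphPoint e g ⁻¹' (W ∩ O) ∈ 𝓝 (projHyperplane e h.norm_eq z) := by
    refine h.continuous_graphPoint.continuousAt ?_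
    rw [hz']
    exact inter_mem (h.isOpen.mem_nhds hzW) hO
  obtain ⟨p, hp, hpP⟩ := (mem_closure_iff_nhds.1 (hd (projHyperplane e h.norm_eq z))) _ hn
  exact ⟨graphPoint e g p, ⟨h.graphPoint_mem_frontier hp.1, hp.2⟩, hpP hp.1⟩

/-- Near a boundary point, an `L`-starshaped domain contains with a point the part of the ray
towards the origin. -/
theorem exists_nhds_smul_mem {γ : ℝ} {Ω : Set (GSpace N l)}
    (hlip : HasLipschitzBoundary Ω) (hstar : IsLStarshaped γ Ω) {z : GSpace N l}
    (hz : z ∈ frontier Ω) :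
    ∃ O ∈ 𝓝 z, ∀ w ∈ Ω ∩ O, ∀ t : ℝ, 0 < t → t ≤ 1 → t • w ∈ O → t • w ∈ Ω := by
  obtain ⟨W, e, K, g, hzW, h⟩ := hlip.exists_isGraphChart hz
  have hz' := h.graphPoint_projHyperplane hzW hz
  set p₀ := projHyperplane e h.norm_eq z
  have hn : graphPoint e g ⁻¹' W ∈ 𝓝 p₀ := by
    refine h.continuous_graphPoint.continuousAt ?_
    rw [hz']
    exact h.isOpen.mem_nhds hzW
  obtain ⟨r, hr, hball⟩ := Metric.mem_nhds_iff.1 hn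
  -- If `τ * g p < g (τ p)`, the dilated graph point would lie below the graph, hence in `Ω`,
  -- against the fact that the ray leaves the closure.
  have hgood : ∀ᵐ p : (ℝ ∙ e)ᗮ ∂(Measure.hausdorffMeasure (Module.finrank ℝ (ℝ ∙ e)ᗮ)),
      p ∈ ball p₀ r → ∀ᶠ τ in 𝓝[>] (1 : ℝ), g ((τ • p : (ℝ ∙ e)ᗮ)) ≤ τ * g p := by
    filter_upwards [h.ae_hyperplane hstar.ae_eventually_smul_notMem_closure] with p hp hpb
    have hpW : graphPoint e g p ∈ W := hball hpb
    have ht : Tendsto (fun τ : ℝ => τ • graphPoint e g p) (𝓝[>] 1) (𝓝 (graphPoint e g p)) := by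
      have : Tendsto (fun τ : ℝ => τ • graphPoint e g p) (𝓝 1) (𝓝 ((1 : ℝ) • graphPoint e g p)) :=
        (continuous_id.smul continuous_const).tendsto 1
      rw [one_smul] at this
      exact this.mono_left nhdsWithin_le_nhds
    filter_upwards [hp hpW, ht.eventually (h.isOpen.mem_nhds hpW)] with τ hτ hτW
    have heq : τ • graphPoint e g p = ((τ • p : (ℝ ∙ e)ᗮ) : GSpace N l) + (τ * g p) • e := by
      simp [graphPoint, smul_smul]
    rw [heq] at hτ hτW
    by_contra! hlt
    exact hτ (subset_closure ((h.mem_iff_lt hτW).2 hlt))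
  have hG : LipschitzWith (K * 1) fun p : (ℝ ∙ e)ᗮ => g p :=
    h.lipschitz.comp (LipschitzWith.subtype_val _)
  refine ⟨W ∩ projHyperplane e h.norm_eq ⁻¹' ball p₀ r, inter_mem (h.isOpen.mem_nhds hzW)
    ((continuous_projHyperplane h.norm_eq).continuousAt (ball_mem_nhds _ hr)), ?_⟩
  rintro w ⟨hwΩ, hwW, hwb⟩ t ht0 ht1 ⟨htW, htb⟩
  set p := projHyperplane e h.norm_eq w
  have hw : (p : GSpace N l) + ⟪w, e⟫_ℝ • e = w := coe_projHyperplane_add h.norm_eq w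
  have htw : ((t • p : (ℝ ∙ e)ᗮ) : GSpace N l) + (t * ⟪w, e⟫_ℝ) • e = t • w := by
    conv_rhs => rw [← hw]
    simp [smul_smul]
  rw [mem_preimage, projHyperplane_smul] at htb
  -- Monotonicity between the parameters `t` and `1` gives `t * g p ≤ g (t p)`: shrinking a point
  -- below the graph keeps it below.
  have h1 := hG.div_le_div_of_ae_ray _ isOpen_ball (convex_ball p₀ r) hgood ht0 ht1 htb
    (by rw [one_smul]; exact hwb)
  rw [one_smul, div_one, le_div_iff₀ ht0] at h1
  have h2 : ⟪w, e⟫_ℝ < g p := by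
    rw [← hw] at hwΩ hwW
    exact (h.mem_iff_lt hwW).1 hwΩ
  rw [← htw] at htW ⊢
  refine (h.mem_iff_lt htW).2 (lt_of_lt_of_le ?_ h1)
  rw [mul_comm]
  exact mul_lt_mul_of_pos_right h2 ht0

/-- An `L`-starshaped domain is starshaped with respect to the origin. -/
theorem IsLStarshaped.smul_mem {γ : ℝ} {Ω : Set (GSpace N l)} (hΩ : IsOpen Ω)
    (hlip : HasLipschitzBoundary Ω) (hstar : IsLStarshaped γ Ω) {z : GSpace N l} (hz : z ∈ Ω)
    {t : ℝ} (ht0 : 0 < t) (ht1 : t ≤ 1) : t • z ∈ Ω := by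
  by_contra htz
  have hc : Continuous fun s : ℝ => s • z := continuous_id.smul continuous_const
  -- At the largest bad parameter `s` the point `s • z` is on the frontier, while the points just
  -- above it on the ray are in `Ω`; the local statement then pulls `s • z` back into `Ω`.
  let S : Set ℝ := {s | s ∈ Icc t 1 ∧ s • z ∉ Ω}
  have hScl : IsClosed S := isClosed_Icc.inter (hΩ.isClosed_compl.preimage hc)
  have hSne : S.Nonempty := ⟨t, ⟨le_rfl, ht1⟩, htz⟩
  have hSb : BddAbove S := ⟨1, fun s hs => hs.1.2⟩
  have hs := hScl.csSup_mem hSne hSb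
  set s := sSup S
  have hs1 : s < 1 := lt_of_le_of_ne hs.1.2 fun h => hs.2 (by rw [h, one_smul]; exact hz)
  have hs0 : 0 < s := ht0.trans_le hs.1.1
  have habove : ∀ r, s < r → r ≤ 1 → r • z ∈ Ω := fun r hr hr1 => by
    by_contra hrΩ
    exact not_le_of_gt hr (le_csSup hSb ⟨⟨hs.1.1.trans hr.le, hr1⟩, hrΩ⟩)
  have htend : Tendsto (fun r : ℝ => r • z) (𝓝[>] s) (𝓝 (s • z)) :=
    (hc.tendsto s).mono_left nhdsWithin_le_nhds
  have hfr : s • z ∈ frontier Ω := by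
    rw [hΩ.frontier_eq]
    refine ⟨mem_closure_of_tendsto htend ?_, hs.2⟩
    filter_upwards [Ioo_mem_nhdsGT hs1] with r hr using habove r hr.1 hr.2.le
  obtain ⟨O, hO, hloc⟩ := exists_nhds_smul_mem hlip hstar hfr
  have hIoo : ∀ᶠ r in 𝓝[>] s, r ∈ Ioo s 1 := Ioo_mem_nhdsGT hs1
  obtain ⟨r, hr, hrO⟩ := (hIoo.and (htend.eventually hO)).exists
  have hr0 : 0 < r := hs0.trans hr.1
  have heq : (s / r) • r • z = s • z := by rw [smul_smul, div_mul_cancel₀ _ hr0.ne']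
  have := hloc (r • z) ⟨habove r hr.1 hr.2.le, hrO⟩ (s / r) (div_pos hs0 hr0)
    ((div_le_one hr0).2 hr.1.le) (by rw [heq]; exact mem_of_mem_nhds hO)
  rw [heq] at this
  exact hs.2 this

/-- The closure of an open set with Lipschitz boundary has unique derivatives. -/
theorem HasLipschitzBoundary.uniqueDiffOn_closure {Ω : Set (GSpace N l)} (hΩ : IsOpen Ω)
    (hlip : HasLipschitzBoundary Ω) : UniqueDiffOn ℝ (closure Ω) := by
  intro z hz
  by_cases hzΩ : z ∈ Ω
  · exact (hΩ.uniqueDiffWithinAt hzΩ).mono subset_closure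
  have hfr : z ∈ frontier Ω := by rw [hΩ.frontier_eq]; exact ⟨hz, hzΩ⟩
  obtain ⟨W, e, K, g, hzW, h⟩ := hlip.exists_isGraphChart hfr
  obtain ⟨r, hr, hball⟩ := Metric.mem_nhds_iff.1 (h.isOpen.mem_nhds hzW)
  -- `q < 0` is the open convex cone with vertex `z` and opening given by the Lipschitz constant;
  -- near `z` it lies below the graph.
  let q : GSpace N l → ℝ := fun w =>
    ⟪w - z, e⟫_ℝ + K * ‖(w - z) - ⟪w - z, e⟫_ℝ • e‖
  have hq : Continuous q := by fun_prop
  let C : Set (GSpace N l) := {w | q w < 0} ∩ ball z r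
  have hCo : IsOpen C := (isOpen_lt hq continuous_const).inter isOpen_ball
  have hqc : ConvexOn ℝ univ q := by
    refine ⟨convex_univ, fun v _ w _ a b ha hb hab => ?_⟩
    have h1 : a • v + b • w - z = a • (v - z) + b • (w - z) := by
      have : z = (a + b) • z := by rw [hab, one_smul]
      conv_lhs => rw [this]
      simp only [smul_sub, add_smul]; abel
    have h2 : (a • v + b • w - z) - ⟪a • v + b • w - z, e⟫_ℝ • e
        = a • ((v - z) - ⟪v - z, e⟫_ℝ • e) + b • ((w - z) - ⟪w - z, e⟫_ℝ • e) := by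
      rw [h1, inner_add_left, real_inner_smul_left, real_inner_smul_left]
      simp only [smul_sub, add_smul, smul_smul]; abel
    have h3 : ‖(a • v + b • w - z) - ⟪a • v + b • w - z, e⟫_ℝ • e‖
        ≤ a * ‖(v - z) - ⟪v - z, e⟫_ℝ • e‖ + b * ‖(w - z) - ⟪w - z, e⟫_ℝ • e‖ := by
      rw [h2]
      refine (norm_add_le _ _).trans (le_of_eq ?_)
      rw [norm_smul, norm_smul, Real.norm_of_nonneg ha, Real.norm_of_nonneg hb]
    have h4 : ⟪a • v + b • w - z, e⟫_ℝ = a * ⟪v - z, e⟫_ℝ + b * ⟪w - z, e⟫_ℝ := by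
      rw [h1, inner_add_left, real_inner_smul_left, real_inner_smul_left]
    have h5 := mul_le_mul_of_nonneg_left h3 K.coe_nonneg
    change ⟪a • v + b • w - z, e⟫_ℝ + K * ‖(a • v + b • w - z) - ⟪a • v + b • w - z, e⟫_ℝ • e‖
      ≤ a * q v + b * q w
    calc _ ≤ _ := add_le_add h4.le h5
      _ = _ := by simp only [q]; ring
  have hCc : Convex ℝ C := by
    have := (hqc.convex_lt 0).inter (convex_ball z r)
    simpa [C] using this
  have hzval := h.inner_eq hzW hfr
  have hCΩ : C ⊆ Ω := by
    rintro w ⟨hw, hwb⟩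
    refine (h.mem_iff w (hball hwb)).2 ?_
    have h1 := h.lipschitz.dist_le_mul (w - ⟪w, e⟫_ℝ • e) (z - ⟪z, e⟫_ℝ • e)
    rw [Real.dist_eq, dist_eq_norm] at h1
    have h2 : (w - ⟪w, e⟫_ℝ • e) - (z - ⟪z, e⟫_ℝ • e) = (w - z) - ⟪w - z, e⟫_ℝ • e := by
      rw [inner_sub_left, sub_smul]; abel
    rw [h2] at h1
    have h3 := (abs_le.1 h1).1
    have hw' : ⟪w - z, e⟫_ℝ + K * ‖(w - z) - ⟪w - z, e⟫_ℝ • e‖ < 0 := hw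
    have h4 : ⟪w - z, e⟫_ℝ = ⟪w, e⟫_ℝ - ⟪z, e⟫_ℝ := inner_sub_left _ _ _
    linarith
  have htend : Tendsto (fun c : ℝ => z - c • e) (𝓝[>] 0) (𝓝 z) := by
    have : Tendsto (fun c : ℝ => z - c • e) (𝓝 0) (𝓝 (z - (0 : ℝ) • e)) :=
      (show Continuous fun c : ℝ => z - c • e by fun_prop).tendsto 0
    rw [zero_smul, sub_zero] at this
    exact this.mono_left nhdsWithin_le_nhds
  have hev : ∀ᶠ c in 𝓝[>] (0 : ℝ), z - c • e ∈ C := by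
    filter_upwards [htend.eventually (ball_mem_nhds z hr), self_mem_nhdsWithin] with c hc hc0
    refine ⟨?_, hc⟩
    have h1 : z - c • e - z = (-c) • e := by simp
    have h2 : ⟪(-c) • e, e⟫_ℝ = -c := by
      rw [real_inner_smul_left, real_inner_self_eq_norm_sq, h.norm_eq]; simp
    simp only [mem_ofPred_eq, q, h1, h2, sub_self, norm_zero, mul_zero, add_zero]
    exact neg_lt_zero.2 hc0
  refine UniqueDiffWithinAt.mono (uniqueDiffWithinAt_convex hCc ?_
    (mem_closure_of_tendsto htend hev)) (hCΩ.trans subset_closure)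
  rw [hCo.interior_eq]
  exact ⟨_, hev.exists.choose_spec⟩

end Charts

/-! ### Mollification of test functions -/

section Approximation

variable {F : Type*} [NormedAddCommGroup F] [NormedSpace ℝ F] [FiniteDimensional ℝ F]

/-- Smooth functions supported in an open set are dense in the `C^1` functions supported there. -/
theorem exists_contDiff_infty_approx {φ : F → ℝ} (hφ : ContDiff ℝ 1 φ)
    (hc : HasCompactSupport φ) {Ω : Set F} (hΩ : IsOpen Ω) (hsub : tsupport φ ⊆ Ω) {ε : ℝ}
    (hε : 0 < ε) :
    ∃ φ' : F → ℝ, ContDiff ℝ ∞ φ' ∧ HasCompactSupport φ' ∧ tsupport φ' ⊆ Ω ∧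
      (∀ z, |φ' z - φ z| ≤ ε) ∧ ∀ z, ‖fderiv ℝ φ' z - fderiv ℝ φ z‖ ≤ ε := by
  borelize F
  let μ : Measure F := Measure.addHaar
  have hcK : IsCompact (tsupport φ) := hc
  obtain ⟨δ, hδ, hδΩ⟩ := hcK.exists_cthickening_subset_open hΩ hsub
  have hdc : Continuous (fderiv ℝ φ) := hφ.continuous_fderiv one_ne_zero
  have hu1 := hc.uniformContinuous_of_continuous hφ.continuous
  have hu2 := (hc.fderiv (𝕜 := ℝ)).uniformContinuous_of_continuous hdc
  obtain ⟨δ₁, hδ₁, h1⟩ := Metric.uniformContinuous_iff.1 hu1 ε hε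
  obtain ⟨δ₂, hδ₂, h2⟩ := Metric.uniformContinuous_iff.1 hu2 ε hε
  -- The mollification radius is small enough for the support to stay in `Ω` and for `φ` and its
  -- derivative to oscillate by less than `ε`.
  let η := min δ (min δ₁ δ₂)
  have hη : 0 < η := lt_min hδ (lt_min hδ₁ hδ₂)
  let ρ : ContDiffBump (0 : F) := ⟨η / 2, η, half_pos hη, half_lt_self hη⟩
  have hloc : LocallyIntegrable (ρ.normed μ) μ :=
    ρ.integrable_normed.locallyIntegrable
  let φ' : F → ℝ := convolution (ρ.normed μ) φ (ContinuousLinearMap.lsmul ℝ ℝ) μ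
  have hdist : ∀ a δ', (∀ x ∈ ball a η, dist (φ x) (φ a) ≤ δ') → dist (φ' a) (φ a) ≤ δ' :=
    fun a δ' h => ρ.dist_normed_convolution_le hφ.continuous.aestronglyMeasurable h
  have hsupp : tsupport φ' ⊆ cthickening δ (tsupport φ) := by
    refine closure_minimal (fun a ha => ?_) isClosed_cthickening
    by_contra hac
    have hball : ∀ x ∈ ball a η, φ x = 0 := fun x hx => by
      by_contra hx0
      refine hac (mem_cthickening_of_dist_le a x δ _ (subset_closure hx0) ?_)
      rw [dist_comm]
      exact (mem_ball.1 hx).le.trans (min_le_left _ _)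
    have h0 := hdist a 0 fun x hx => by rw [hball x hx, hball a (mem_ball_self hη), dist_self]
    rw [hball a (mem_ball_self hη)] at h0
    exact ha (dist_le_zero.1 h0)
  refine ⟨φ', ?_, ?_, hsupp.trans hδΩ, fun z => ?_, fun z => ?_⟩
  · exact ρ.hasCompactSupport_normed.contDiff_convolution_left _ ρ.contDiff_normed
      hφ.continuous.locallyIntegrable
  · exact (hcK.cthickening).of_isClosed_subset (isClosed_tsupport _) hsupp
  · rw [← Real.dist_eq]
    exact hdist z ε fun x hx => (h1 ((mem_ball.1 hx).trans_le
      ((min_le_right _ _).trans (min_le_left _ _)))).le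
  · have h3 := hc.hasFDerivAt_convolution_right (ContinuousLinearMap.lsmul ℝ ℝ) hloc hφ z
    rw [h3.fderiv, ← dist_eq_norm]
    have h4 : convolution (ρ.normed μ) (fderiv ℝ φ)
        ((ContinuousLinearMap.lsmul ℝ ℝ).precompR F) μ z
        = convolution (ρ.normed μ) (fderiv ℝ φ) (ContinuousLinearMap.lsmul ℝ ℝ) μ z := by
      refine integral_congr_ae (Eventually.of_forall fun t => ?_)
      ext x
      simp [ContinuousLinearMap.precompR_apply]
    rw [h4]
    exact ρ.dist_normed_convolution_le hdc.aestronglyMeasurable fun x hx =>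
      (h2 ((mem_ball.1 hx).trans_le ((min_le_right _ _).trans (min_le_right _ _)))).le

end Approximation

/-! ### A continuously differentiable truncation -/

section Truncation

/-- A `C^1` truncation of the identity, vanishing on `(-∞, ε]`. -/
def truncId (ε s : ℝ) : ℝ := max s ε - 2 * ε + ε ^ 2 / max s ε

/-- The derivative of `truncId ε`. -/
def truncIdDeriv (ε s : ℝ) : ℝ := 1 - (ε / max s ε) ^ 2

variable {ε : ℝ}

theorem truncId_of_le (hε : 0 < ε) {s : ℝ} (hs : s ≤ ε) : truncId ε s = 0 := by
  rw [truncId, max_eq_right hs, pow_two, mul_div_cancel_right₀ _ hε.ne']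
  ring

theorem truncIdDeriv_of_le (hε : 0 < ε) {s : ℝ} (hs : s ≤ ε) : truncIdDeriv ε s = 0 := by
  rw [truncIdDeriv, max_eq_right hs, div_self hε.ne']
  ring

theorem max_pos_of_pos_right (hε : 0 < ε) (s : ℝ) : 0 < max s ε := lt_max_of_lt_right hε

theorem continuous_truncId (hε : 0 < ε) : Continuous (truncId ε) := by
  have h : Continuous fun s : ℝ => max s ε := continuous_id.max continuous_const
  exact (h.sub continuous_const).add
    (continuous_const.div h fun s => (max_pos_of_pos_right hε s).ne')

theorem continuous_truncIdDeriv (hε : 0 < ε) : Continuous (truncIdDeriv ε) := by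
  have h : Continuous fun s : ℝ => max s ε := continuous_id.max continuous_const
  exact continuous_const.sub
    ((continuous_const.div h fun s => (max_pos_of_pos_right hε s).ne').pow 2)

theorem hasDerivAt_truncId (hε : 0 < ε) (s : ℝ) :
    HasDerivAt (truncId ε) (truncIdDeriv ε s) s := by
  have hne : ∀ s, s ≠ ε → HasDerivAt (truncId ε) (truncIdDeriv ε s) s := by
    intro s hs
    rcases lt_or_gt_of_ne hs with h | h
    · rw [truncIdDeriv_of_le hε h.le]
      refine (hasDerivAt_const s (0 : ℝ)).congr_of_eventuallyEq ?_
      filter_upwards [Iio_mem_nhds h] with t ht using truncId_of_le hε (le_of_lt ht)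
    · have hs0 : s ≠ 0 := (hε.trans h).ne'
      have h1 : HasDerivAt (fun t : ℝ => t - 2 * ε + ε ^ 2 / t) (truncIdDeriv ε s) s := by
        have h2 : HasDerivAt (fun t : ℝ => t - 2 * ε + ε ^ 2 / t)
            (1 + ε ^ 2 * -(s ^ 2)⁻¹) s := ((hasDerivAt_id s).sub_const (2 * ε)).add
          ((hasDerivAt_inv hs0).const_mul (ε ^ 2))
        refine h2.congr_deriv ?_
        rw [truncIdDeriv, max_eq_left h.le]
        field_simp
        ring
      refine h1.congr_of_eventuallyEq ?_
      filter_upwards [Ioi_mem_nhds h] with t ht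
      rw [truncId, max_eq_left (le_of_lt ht)]
  by_cases hs : s = ε
  · rw [hs]
    exact hasDerivAt_of_hasDerivAt_of_ne (fun y hy => hne y hy)
      (continuous_truncId hε).continuousAt (continuous_truncIdDeriv hε).continuousAt
  · exact hne s hs

theorem truncIdDeriv_nonneg (hε : 0 < ε) (s : ℝ) : 0 ≤ truncIdDeriv ε s := by
  have h1 : ε / max s ε ≤ 1 := (div_le_one (max_pos_of_pos_right hε s)).2 (le_max_right _ _)
  have h2 : 0 ≤ ε / max s ε := (div_pos hε (max_pos_of_pos_right hε s)).le
  have := pow_le_one₀ (n := 2) h2 h1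
  rw [truncIdDeriv]
  linarith

theorem truncIdDeriv_le_one (s : ℝ) : truncIdDeriv ε s ≤ 1 := by
  have := sq_nonneg (ε / max s ε)
  rw [truncIdDeriv]
  linarith

theorem abs_truncIdDeriv_le (hε : 0 < ε) (s : ℝ) : |truncIdDeriv ε s| ≤ 1 := by
  rw [abs_of_nonneg (truncIdDeriv_nonneg hε s)]
  exact truncIdDeriv_le_one s

theorem truncId_nonneg (hε : 0 < ε) (s : ℝ) : 0 ≤ truncId ε s := by
  have h := max_pos_of_pos_right hε s
  have : truncId ε s = (max s ε - ε) ^ 2 / max s ε := by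
    rw [truncId]
    field_simp
    ring
  rw [this]
  positivity

theorem truncId_le (hε : 0 < ε) {s : ℝ} (hs : 0 ≤ s) : truncId ε s ≤ s := by
  rcases le_total s ε with h | h
  · rw [truncId_of_le hε h]
    exact hs
  · rw [truncId, max_eq_left h]
    have : ε ^ 2 / s ≤ ε := by
      rw [div_le_iff₀ (hε.trans_le h)]
      nlinarith
    linarith

theorem tendsto_truncId {s : ℝ} (hs : 0 ≤ s) :
    Tendsto (fun ε => truncId ε s) (𝓝[>] 0) (𝓝 s) := by
  rcases hs.eq_or_lt with rfl | hs
  · refine tendsto_const_nhds.congr' ?_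
    filter_upwards [self_mem_nhdsWithin] with ε hε
    rw [truncId_of_le hε (le_of_lt hε)]
  · have h : Tendsto (fun ε : ℝ => s - 2 * ε + ε ^ 2 / s) (𝓝 0) (𝓝 (s - 2 * 0 + 0 ^ 2 / s)) :=
      (show Continuous fun ε : ℝ => s - 2 * ε + ε ^ 2 / s by fun_prop).tendsto 0
    simp only [mul_zero, sub_zero, ne_eq, OfNat.ofNat_ne_zero, not_false_eq_true, zero_pow,
      zero_div, add_zero] at h
    refine (h.mono_left nhdsWithin_le_nhds).congr' ?_
    filter_upwards [Ioo_mem_nhdsGT hs] with ε hε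
    rw [truncId, max_eq_left hε.2.le]

theorem tendsto_truncIdDeriv {s : ℝ} (hs : 0 < s) :
    Tendsto (fun ε => truncIdDeriv ε s) (𝓝[>] 0) (𝓝 1) := by
  have h : Tendsto (fun ε : ℝ => 1 - (ε / s) ^ 2) (𝓝 0) (𝓝 (1 - (0 / s) ^ 2)) :=
    (show Continuous fun ε : ℝ => 1 - (ε / s) ^ 2 by fun_prop).tendsto 0
  simp only [zero_div, ne_eq, OfNat.ofNat_ne_zero, not_false_eq_true, zero_pow, sub_zero] at h
  refine (h.mono_left nhdsWithin_le_nhds).congr' ?_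
  filter_upwards [Ioo_mem_nhdsGT hs] with ε hε
  rw [truncIdDeriv, max_eq_left hε.2.le]

end Truncation

/-! ### Extension by zero -/

section ZeroExtension

variable {F : Type*} [NormedAddCommGroup F] [InnerProductSpace ℝ F] [CompleteSpace F]

/-- `v` is a nonnegative continuous function vanishing off `Ω`, of class `C^1` in `Ω` with gradient
`D` bounded by `M`; off `Ω` we put `D = 0`. -/
structure IsZeroExtension (Ω : Set F) (v : F → ℝ) (D : F → F) (M : ℝ) : Prop where
  isOpen : IsOpen Ω
  continuous : Continuous v
  pos : ∀ z ∈ Ω, 0 < v z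
  eq_zero : ∀ z ∉ Ω, v z = 0
  hasGradientAt : ∀ z ∈ Ω, HasGradientAt v (D z) z
  continuousOn : ContinuousOn D Ω
  grad_eq_zero : ∀ z ∉ Ω, D z = 0
  norm_le : ∀ z, ‖D z‖ ≤ M

namespace IsZeroExtension

variable {Ω : Set F} {v : F → ℝ} {D : F → F} {M ε : ℝ}

theorem nonneg (h : IsZeroExtension Ω v D M) (z : F) : 0 ≤ v z := by
  by_cases hz : z ∈ Ω
  · exact (h.pos z hz).le
  · exact (h.eq_zero z hz).ge

theorem bound_nonneg (h : IsZeroExtension Ω v D M) : 0 ≤ M := (norm_nonneg _).trans (h.norm_le 0)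

theorem eventually_lt (h : IsZeroExtension Ω v D M) (hε : 0 < ε) {z : F} (hz : z ∉ Ω) :
    ∀ᶠ w in 𝓝 z, v w < ε :=
  (isOpen_lt h.continuous continuous_const).mem_nhds (by
    change v z < ε
    rw [h.eq_zero z hz]
    exact hε)

/-- Off `Ω` the function `v` is below `ε` in a neighbourhood, so its truncation is locally zero.
Thus truncation removes the kink of `v` at the boundary. -/
theorem hasGradientAt_truncId (h : IsZeroExtension Ω v D M) (hε : 0 < ε) (z : F) :
    HasGradientAt (fun z => truncId ε (v z)) (truncIdDeriv ε (v z) • D z) z := by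
  by_cases hz : z ∈ Ω
  · rw [hasGradientAt_iff_hasFDerivAt, map_smul]
    exact (hasDerivAt_truncId hε (v z)).comp_hasFDerivAt z (h.hasGradientAt z hz).hasFDerivAt
  · rw [h.grad_eq_zero z hz, smul_zero]
    refine HasGradientAt.congr_of_eventuallyEq (hasGradientAt_const z (0 : ℝ)) ?_
    filter_upwards [h.eventually_lt hε hz] with w hw using truncId_of_le hε hw.le

theorem continuous_truncIdDeriv_smul (h : IsZeroExtension Ω v D M) (hε : 0 < ε) :
    Continuous fun z => truncIdDeriv ε (v z) • D z := by
  rw [continuous_iff_continuousAt]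
  intro z
  by_cases hz : z ∈ Ω
  · exact ((continuous_truncIdDeriv hε).comp h.continuous).continuousAt.smul
      (h.continuousOn.continuousAt (h.isOpen.mem_nhds hz))
  · refine (continuousAt_const (y := (0 : F))).congr ?_
    filter_upwards [h.eventually_lt hε hz] with w hw
    rw [truncIdDeriv_of_le hε hw.le, zero_smul]

theorem hasGradientAt_truncId_smul (h : IsZeroExtension Ω v D M) (hε : 0 < ε) (c : ℝ) (z : F) :
    HasGradientAt (fun z => truncId ε (v (c • z)))
      (truncIdDeriv ε (v (c • z)) • c • D (c • z)) z := by
  have h1 := (h.hasGradientAt_truncId hε (c • z)).hasFDerivAt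
  have h2 : HasFDerivAt (fun z : F => c • z) (c • ContinuousLinearMap.id ℝ F) z :=
    (hasFDerivAt_id z).const_smul c
  have h3 := h1.comp z h2
  rw [hasGradientAt_iff_hasFDerivAt]
  refine h3.congr_fderiv ?_
  ext w
  simp
  ring

theorem contDiff_truncId_smul (h : IsZeroExtension Ω v D M) (hε : 0 < ε) (c : ℝ) :
    ContDiff ℝ 1 fun z => truncId ε (v (c • z)) := by
  rw [contDiff_one_iff_fderiv]
  refine ⟨fun z => (h.hasGradientAt_truncId_smul hε c z).differentiableAt, ?_⟩
  have : fderiv ℝ (fun z => truncId ε (v (c • z))) = fun z =>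
      InnerProductSpace.toDual ℝ F (truncIdDeriv ε (v (c • z)) • c • D (c • z)) := by
    ext1 z
    exact (h.hasGradientAt_truncId_smul hε c z).hasFDerivAt.fderiv
  rw [this]
  refine (InnerProductSpace.toDual ℝ F).continuous.comp ?_
  have h1 := ((h.continuous_truncIdDeriv_smul hε).comp (continuous_const_smul c)).const_smul c
  exact h1.congr fun z => smul_comm _ _ _

/-- The support lies in the closed set `ε ≤ v (c • z)`, which stays off the boundary; this makes
truncated dilations legitimate test functions. -/
theorem tsupport_truncId_smul_subset (h : IsZeroExtension Ω v D M) (hε : 0 < ε) (c : ℝ) :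
    tsupport (fun z => truncId ε (v (c • z))) ⊆ (c • ·) ⁻¹' Ω := by
  have hcl : IsClosed {z : F | ε ≤ v (c • z)} :=
    isClosed_le continuous_const (h.continuous.comp (continuous_const_smul c))
  refine (closure_minimal (fun z hz => ?_) hcl).trans fun z hz => ?_
  · by_contra hlt
    exact hz (truncId_of_le hε (le_of_lt (not_le.1 hlt)))
  · by_contra hΩ
    have h1 : ε ≤ v (c • z) := hz
    rw [h.eq_zero _ hΩ] at h1
    exact not_lt_of_ge h1 hε

/-- The extension by zero is Lipschitz. -/
theorem abs_sub_le (h : IsZeroExtension Ω v D M) (z w : F) : |v z - v w| ≤ M * ‖z - w‖ := by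
  have h1 : ∀ ε > 0, |truncId ε (v z) - truncId ε (v w)| ≤ M * ‖z - w‖ := by
    intro ε hε
    have := Convex.norm_image_sub_le_of_norm_hasFDerivWithin_le (𝕜 := ℝ) (s := univ) (C := M)
      (fun x _ => (h.hasGradientAt_truncId hε x).hasFDerivAt.hasFDerivWithinAt)
      (fun x _ => ?_) convex_univ (mem_univ w) (mem_univ z)
    · simpa using this
    · rw [LinearIsometryEquiv.norm_map, norm_smul, Real.norm_eq_abs]
      calc _ ≤ 1 * ‖D x‖ := by gcongr; exact abs_truncIdDeriv_le hε _
        _ ≤ M := by rw [one_mul]; exact h.norm_le x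
  refine le_of_tendsto (((tendsto_truncId (h.nonneg z)).sub
    (tendsto_truncId (h.nonneg w))).abs) ?_
  filter_upwards [self_mem_nhdsWithin] with ε hε using h1 ε hε

theorem measurable_grad [MeasurableSpace F] [BorelSpace F] (h : IsZeroExtension Ω v D M) :
    Measurable D := by
  classical
  have h1 : D = Ω.piecewise D 0 := by
    ext1 z
    by_cases hz : z ∈ Ω
    · simp [hz]
    · simp [hz, h.grad_eq_zero z hz]
  rw [h1]
  exact h.continuousOn.measurable_piecewise continuousOn_const h.isOpen.measurableSet

theorem exists_bound (h : IsZeroExtension Ω v D M) [FiniteDimensional ℝ F]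
    (hb : Bornology.IsBounded Ω) : ∃ A, 0 < A ∧ ∀ z, v z ≤ A := by
  have hc : HasCompactSupport v := HasCompactSupport.of_support_subset_isCompact
    hb.isCompact_closure fun z hz => subset_closure (by
      by_contra hzΩ
      exact hz (h.eq_zero z hzΩ))
  have := FiniteDimensional.proper_real F
  obtain ⟨A, hA⟩ := h.continuous.bounded_above_of_compact_support hc
  exact ⟨max A 1, by positivity, fun z => ((le_abs_self _).trans (hA z)).trans (le_max_left _ _)⟩

end IsZeroExtension

/-- A positive function of class `C^1` up to the boundary, zero there, extended by zero. -/
theorem exists_isZeroExtension [FiniteDimensional ℝ F] {Ω : Set F} (hΩ : IsOpen Ω)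
    (hb : Bornology.IsBounded Ω) (hu : UniqueDiffOn ℝ (closure Ω)) {u : F → ℝ}
    (hc : ContDiffOn ℝ 1 u (closure Ω)) (hpos : ∀ z ∈ Ω, 0 < u z)
    (h0 : ∀ z ∈ frontier Ω, u z = 0) :
    ∃ M, IsZeroExtension Ω (Ω.indicator u) (Ω.indicator (gradient u)) M := by
  have hd := hc.continuousOn_fderivWithin hu le_rfl
  have heq : ∀ z ∈ Ω, fderivWithin ℝ u (closure Ω) z = fderiv ℝ u z := fun z hz =>
    fderivWithin_of_mem_nhds (mem_of_superset (hΩ.mem_nhds hz) subset_closure)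
  obtain ⟨M, hM⟩ := hb.isCompact_closure.exists_bound_of_continuousOn hd
  refine ⟨max M 0, hΩ, ?_, fun z hz => ?_, fun z hz => ?_, fun z hz => ?_, ?_, fun z hz => ?_,
    fun z => ?_⟩
  · exact continuous_indicator h0 hc.continuousOn
  · rw [indicator_of_mem hz]
    exact hpos z hz
  · exact indicator_of_notMem hz u
  · rw [indicator_of_mem hz]
    have hdiff : DifferentiableAt ℝ u z := (hc.differentiableOn one_ne_zero).differentiableAt
      (mem_of_superset (hΩ.mem_nhds hz) subset_closure)
    refine hdiff.hasGradientAt.congr_of_eventuallyEq ?_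
    filter_upwards [hΩ.mem_nhds hz] with w hw using indicator_of_mem hw u
  · refine ContinuousOn.congr (f := gradient u) ?_ fun z hz => indicator_of_mem hz _
    have : ContinuousOn (fderiv ℝ u) Ω :=
      (hd.mono subset_closure).congr fun z hz => (heq z hz).symm
    exact (InnerProductSpace.toDual ℝ F).symm.continuous.comp_continuousOn this
  · exact indicator_of_notMem hz _
  · by_cases hz : z ∈ Ω
    · rw [indicator_of_mem hz, gradient, LinearIsometryEquiv.norm_map, ← heq z hz]
      exact (hM z (subset_closure hz)).trans (le_max_left _ _)
    · rw [indicator_of_notMem hz, norm_zero]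
      exact le_max_right _ _

end ZeroExtension

/-! ### The Grushin quadratic form -/

section Form

variable {N l : ℕ}

theorem xPart_smul (c : ℝ) (z : GSpace N l) : xPart (c • z) = c • xPart z := by
  ext i; simp [xPart]

theorem yPart_smul (c : ℝ) (z : GSpace N l) : yPart (c • z) = c • yPart z := by
  ext i; simp [yPart]

theorem xPart_sub (z w : GSpace N l) : xPart (z - w) = xPart z - xPart w := by
  ext i; simp [xPart]

theorem yPart_sub (z w : GSpace N l) : yPart (z - w) = yPart z - yPart w := by
  ext i; simp [yPart]

theorem continuous_xPart : Continuous (xPart : GSpace N l → EuclideanSpace ℝ (Fin N)) := by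
  unfold xPart; fun_prop

theorem continuous_yPart : Continuous (yPart : GSpace N l → EuclideanSpace ℝ (Fin l)) := by
  unfold yPart; fun_prop

theorem norm_sq_xPart_add_norm_sq_yPart (z : GSpace N l) :
    ‖xPart z‖ ^ 2 + ‖yPart z‖ ^ 2 = ‖z‖ ^ 2 := by
  rw [← real_inner_self_eq_norm_sq, ← real_inner_self_eq_norm_sq, ← real_inner_self_eq_norm_sq,
    inner_xPart_add_inner_yPart]

theorem norm_xPart_le (z : GSpace N l) : ‖xPart z‖ ≤ ‖z‖ := by
  refine le_of_sq_le_sq ?_ (norm_nonneg _)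
  have := norm_sq_xPart_add_norm_sq_yPart z
  nlinarith [sq_nonneg ‖yPart z‖]

theorem norm_yPart_le (z : GSpace N l) : ‖yPart z‖ ≤ ‖z‖ := by
  refine le_of_sq_le_sq ?_ (norm_nonneg _)
  have := norm_sq_xPart_add_norm_sq_yPart z
  nlinarith [sq_nonneg ‖xPart z‖]

/-- The weight `|x|^(2γ)` of the Grushin operator. -/
def grushinWeight (γ : ℝ) (z : GSpace N l) : ℝ := (‖xPart z‖ ^ γ) ^ 2

/-- The quadratic form `v_x · w_x + |x|^(2γ) v_y · w_y` of the Grushin operator at `z`. -/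
def grushinForm (γ : ℝ) (z v w : GSpace N l) : ℝ :=
  ⟪xPart v, xPart w⟫_ℝ + grushinWeight γ z * ⟪yPart v, yPart w⟫_ℝ

variable {γ : ℝ}

theorem inner_grushinGradient (u φ : GSpace N l → ℝ) (z : GSpace N l) :
    ⟪grushinGradient γ u z, grushinGradient γ φ z⟫_ℝ
      = grushinForm γ z (gradient u z) (gradient φ z) := by
  simp only [grushinGradient, grushinForm, grushinWeight, xPart, yPart, PiLp.inner_apply,
    Fintype.sum_sum_type, Sum.elim_inl, Sum.elim_inr, Finset.mul_sum]
  congr 1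
  refine Finset.sum_congr rfl fun j _ => ?_
  simp only [RCLike.inner_apply, conj_trivial]
  ring

theorem grushinWeight_nonneg (z : GSpace N l) : 0 ≤ grushinWeight γ z := sq_nonneg _

theorem continuous_grushinWeight (hγ : 0 ≤ γ) :
    Continuous (grushinWeight γ : GSpace N l → ℝ) :=
  ((continuous_xPart.norm).rpow_const fun _ => Or.inr hγ).pow 2

theorem grushinWeight_smul {c : ℝ} (hc : 0 < c) (z : GSpace N l) :
    grushinWeight γ (c • z) = c ^ (2 * γ) * grushinWeight γ z := by
  rw [grushinWeight, grushinWeight, xPart_smul, norm_smul, Real.norm_of_nonneg hc.le,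
    Real.mul_rpow hc.le (norm_nonneg _), mul_pow, mul_comm 2 γ, Real.rpow_mul hc.le]
  norm_cast

theorem grushinForm_self (z v : GSpace N l) :
    grushinForm γ z v v = ‖xPart v‖ ^ 2 + grushinWeight γ z * ‖yPart v‖ ^ 2 := by
  rw [grushinForm, real_inner_self_eq_norm_sq, real_inner_self_eq_norm_sq]

theorem grushinForm_self_nonneg (z v : GSpace N l) : 0 ≤ grushinForm γ z v v := by
  rw [grushinForm_self]
  have := grushinWeight_nonneg (γ := γ) z
  positivity

theorem grushinForm_sub_right (z v w w' : GSpace N l) :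
    grushinForm γ z v (w - w') = grushinForm γ z v w - grushinForm γ z v w' := by
  simp only [grushinForm, xPart_sub, yPart_sub, inner_sub_right]
  ring

theorem grushinForm_sub_self (z v w : GSpace N l) :
    grushinForm γ z (v - w) (v - w)
      = grushinForm γ z v v - 2 * grushinForm γ z v w + grushinForm γ z w w := by
  simp only [grushinForm, xPart_sub, yPart_sub, inner_sub_right, inner_sub_left]
  rw [real_inner_comm (xPart w), real_inner_comm (yPart w)]
  ring

theorem abs_grushinForm_le (z v w : GSpace N l) :
    |grushinForm γ z v w| ≤ (1 + grushinWeight γ z) * (‖v‖ * ‖w‖) := by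
  have h1 : |⟪xPart v, xPart w⟫_ℝ| ≤ ‖v‖ * ‖w‖ := (abs_real_inner_le_norm _ _).trans
    (mul_le_mul (norm_xPart_le v) (norm_xPart_le w) (norm_nonneg _) (norm_nonneg _))
  have h2 : |⟪yPart v, yPart w⟫_ℝ| ≤ ‖v‖ * ‖w‖ := (abs_real_inner_le_norm _ _).trans
    (mul_le_mul (norm_yPart_le v) (norm_yPart_le w) (norm_nonneg _) (norm_nonneg _))
  have hω := grushinWeight_nonneg (γ := γ) z
  calc _ ≤ |⟪xPart v, xPart w⟫_ℝ| + |grushinWeight γ z * ⟪yPart v, yPart w⟫_ℝ| := abs_add_le _ _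
    _ ≤ ‖v‖ * ‖w‖ + grushinWeight γ z * (‖v‖ * ‖w‖) := by
      rw [abs_mul, abs_of_nonneg hω]
      gcongr
    _ = _ := by ring

theorem Measurable.grushinForm (hγ : 0 ≤ γ) {A B : GSpace N l → GSpace N l} (hA : Measurable A)
    (hB : Measurable B) : Measurable fun z => grushinForm γ z (A z) (B z) :=
  ((continuous_xPart.measurable.comp hA).inner (continuous_xPart.measurable.comp hB)).add
    ((continuous_grushinWeight hγ).measurable.mul
      ((continuous_yPart.measurable.comp hA).inner (continuous_yPart.measurable.comp hB)))

theorem continuous_grushinForm_right (z v : GSpace N l) :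
    Continuous fun w => grushinForm γ z v w :=
  (continuous_const.inner continuous_xPart).add
    (continuous_const.mul (continuous_const.inner continuous_yPart))

theorem exists_grushinWeight_le (hγ : 0 ≤ γ) {Ω : Set (GSpace N l)}
    (hb : Bornology.IsBounded Ω) : ∃ R, 0 ≤ R ∧ ∀ z ∈ Ω, grushinWeight γ z ≤ R := by
  obtain ⟨R, hR⟩ := hb.isCompact_closure.exists_bound_of_continuousOn
    (continuous_grushinWeight (N := N) (l := l) hγ).continuousOn
  exact ⟨max R 0, le_max_right _ _, fun z hz =>
    ((le_abs_self _).trans (hR z (subset_closure hz))).trans (le_max_left _ _)⟩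

theorem integrableOn_of_measurable_of_bound {Ω : Set (GSpace N l)} (hb : Bornology.IsBounded Ω)
    (hΩ : IsOpen Ω) {f : GSpace N l → ℝ} (hf : Measurable f) {C : ℝ} (hC : ∀ z ∈ Ω, |f z| ≤ C) :
    IntegrableOn f Ω :=
  Measure.integrableOn_of_bounded hb.measure_lt_top.ne hf.aestronglyMeasurable
    (M := C) ((ae_restrict_iff' hΩ.measurableSet).2 (Eventually.of_forall hC))

theorem integrableOn_grushinForm (hγ : 0 ≤ γ) {Ω : Set (GSpace N l)}
    (hb : Bornology.IsBounded Ω) (hΩ : IsOpen Ω) {A B : GSpace N l → GSpace N l}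
    (hA : Measurable A) (hB : Measurable B) {a b : ℝ} (ha : ∀ z, ‖A z‖ ≤ a) (hb' : ∀ z, ‖B z‖ ≤ b) :
    IntegrableOn (fun z => grushinForm γ z (A z) (B z)) Ω := by
  obtain ⟨R, hR0, hR⟩ := exists_grushinWeight_le hγ hb
  refine integrableOn_of_measurable_of_bound hb hΩ (hA.grushinForm hγ hB)
    (C := (1 + R) * (a * b)) fun z hz => (abs_grushinForm_le _ _ _).trans ?_
  have h1 := hR z hz
  have h2 := ha z
  have h3 := hb' z
  have h4 := grushinWeight_nonneg (γ := γ) z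
  have h5 : 0 ≤ a := (norm_nonneg _).trans h2
  gcongr

end Form

/-! ### Enlarging the class of test functions -/

section WeakEquation

variable {N l : ℕ} {γ p : ℝ} {Ω : Set (GSpace N l)} {v : GSpace N l → ℝ}
  {D : GSpace N l → GSpace N l} {M : ℝ}

theorem continuous_gradient_of_contDiff {φ : GSpace N l → ℝ} (hφ : ContDiff ℝ 1 φ) :
    Continuous (gradient φ) :=
  (InnerProductSpace.toDual ℝ _).symm.continuous.comp (hφ.continuous_fderiv one_ne_zero)

theorem HasCompactSupport.exists_norm_gradient_le {φ : GSpace N l → ℝ} (hφ : ContDiff ℝ 1 φ)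
    (hc : HasCompactSupport φ) : ∃ C, ∀ z, ‖gradient φ z‖ ≤ C := by
  obtain ⟨C, hC⟩ := (hc.fderiv (𝕜 := ℝ)).exists_bound_of_continuous
    (hφ.continuous_fderiv one_ne_zero)
  exact ⟨C, fun z => by rw [gradient, LinearIsometryEquiv.norm_map]; exact hC z⟩

theorem IsZeroExtension.integrableOn_rpow_mul (h : IsZeroExtension Ω v D M)
    (hb : Bornology.IsBounded Ω) (hp : 0 ≤ p) {f : GSpace N l → ℝ} (hf : Continuous f) :
    IntegrableOn (fun z => v z ^ p * f z) Ω :=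
  (((h.continuous.rpow_const fun _ => Or.inr hp).mul hf).continuousOn.integrableOn_compact
    hb.isCompact_closure).mono_set subset_closure

/-- The weak equation may be tested against `C^1` functions. -/
theorem IsZeroExtension.weak_eq_contDiff_one (h : IsZeroExtension Ω v D M)
    (hb : Bornology.IsBounded Ω) (hγ : 0 ≤ γ) (hp : 0 ≤ p)
    (hw : ∀ φ : GSpace N l → ℝ, ContDiff ℝ ∞ φ → HasCompactSupport φ → tsupport φ ⊆ Ω →
      ∫ z in Ω, grushinForm γ z (D z) (gradient φ z) = ∫ z in Ω, v z ^ p * φ z)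
    {φ : GSpace N l → ℝ} (hφ : ContDiff ℝ 1 φ) (hc : HasCompactSupport φ) (hs : tsupport φ ⊆ Ω) :
    ∫ z in Ω, grushinForm γ z (D z) (gradient φ z) = ∫ z in Ω, v z ^ p * φ z := by
  obtain ⟨R, hR0, hR⟩ := exists_grushinWeight_le hγ hb
  obtain ⟨A, hA0, hA⟩ := h.exists_bound hb
  have hM := h.bound_nonneg
  have hfin : volume Ω < ⊤ := hb.measure_lt_top
  have key : ∀ ε > 0, |(∫ z in Ω, grushinForm γ z (D z) (gradient φ z))
      - ∫ z in Ω, v z ^ p * φ z| ≤ ε * (((1 + R) * M + A ^ p) * volume.real Ω) := by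
    intro ε hε
    obtain ⟨φ', hφ', hc', hs', h0, h1⟩ := exists_contDiff_infty_approx hφ hc h.isOpen hs hε
    have hφ1 : ContDiff ℝ 1 φ' := hφ'.of_le (by exact_mod_cast le_top)
    obtain ⟨C, hC⟩ := hc.exists_norm_gradient_le hφ
    obtain ⟨C', hC'⟩ := hc'.exists_norm_gradient_le hφ1
    have i1 := integrableOn_grushinForm hγ hb h.isOpen h.measurable_grad
      (continuous_gradient_of_contDiff hφ).measurable h.norm_le hC
    have i2 := integrableOn_grushinForm hγ hb h.isOpen h.measurable_grad
      (continuous_gradient_of_contDiff hφ1).measurable h.norm_le hC'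
    have i3 := h.integrableOn_rpow_mul hb hp hφ.continuous
    have i4 := h.integrableOn_rpow_mul hb hp hφ1.continuous
    have e1 : |(∫ z in Ω, grushinForm γ z (D z) (gradient φ z))
        - ∫ z in Ω, grushinForm γ z (D z) (gradient φ' z)| ≤ (1 + R) * (M * ε) * volume.real Ω := by
      rw [← integral_sub i1 i2, ← Real.norm_eq_abs]
      refine norm_setIntegral_le_of_norm_le_const hfin fun z hz => ?_
      rw [← grushinForm_sub_right]
      refine (abs_grushinForm_le _ _ _).trans ?_
      have hg : ‖gradient φ z - gradient φ' z‖ ≤ ε := by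
        rw [gradient, gradient, ← map_sub, LinearIsometryEquiv.norm_map, norm_sub_rev]
        exact h1 z
      have hD := h.norm_le z
      have hRz := hR z hz
      have h4 := grushinWeight_nonneg (γ := γ) z
      gcongr
    have e2 : |(∫ z in Ω, v z ^ p * φ z) - ∫ z in Ω, v z ^ p * φ' z|
        ≤ A ^ p * ε * volume.real Ω := by
      rw [← integral_sub i3 i4, ← Real.norm_eq_abs]
      refine norm_setIntegral_le_of_norm_le_const hfin fun z hz => ?_
      rw [← mul_sub, norm_mul, Real.norm_of_nonneg (Real.rpow_nonneg (h.nonneg z) p),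
        Real.norm_eq_abs, abs_sub_comm]
      have := Real.rpow_le_rpow (h.nonneg z) (hA z) hp
      have h4 := h0 z
      have h5 : 0 ≤ A ^ p := by positivity
      gcongr
    have e3 := hw φ' hφ' hc' hs'
    rw [abs_le] at e1 e2 ⊢
    constructor <;> nlinarith [e1.1, e1.2, e2.1, e2.2]
  have hlim : Tendsto (fun ε : ℝ => ε * (((1 + R) * M + A ^ p) * volume.real Ω)) (𝓝[>] 0)
      (𝓝 0) := by
    have : Tendsto (fun ε : ℝ => ε * (((1 + R) * M + A ^ p) * volume.real Ω)) (𝓝 0)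
        (𝓝 (0 * (((1 + R) * M + A ^ p) * volume.real Ω))) :=
      (continuous_id.mul continuous_const).tendsto 0
    rw [zero_mul] at this
    exact this.mono_left nhdsWithin_le_nhds
  have h0 := ge_of_tendsto hlim (by
    filter_upwards [self_mem_nhdsWithin] with ε hε using key ε hε)
  exact sub_eq_zero.1 (abs_nonpos_iff.1 h0)

/-- The weak equation may be tested against the rescalings of the solution. -/
theorem IsZeroExtension.weak_eq_smul (h : IsZeroExtension Ω v D M)
    (hb : Bornology.IsBounded Ω) (hγ : 0 ≤ γ) (hp : 0 ≤ p)
    (hw : ∀ φ : GSpace N l → ℝ, ContDiff ℝ ∞ φ → HasCompactSupport φ → tsupport φ ⊆ Ω →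
      ∫ z in Ω, grushinForm γ z (D z) (gradient φ z) = ∫ z in Ω, v z ^ p * φ z)
    {c : ℝ} (hc : (c • ·) ⁻¹' Ω ⊆ Ω) :
    ∫ z in Ω, grushinForm γ z (D z) (c • D (c • z)) = ∫ z in Ω, v z ^ p * v (c • z) := by
  obtain ⟨R, hR0, hR⟩ := exists_grushinWeight_le hγ hb
  obtain ⟨A, hA0, hA⟩ := h.exists_bound hb
  have hM := h.bound_nonneg
  have hfin : volume Ω < ⊤ := hb.measure_lt_top
  have hsm : Measurable fun z : GSpace N l => c • z := measurable_const_smul c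
  have hDc : Measurable fun z => c • D (c • z) := (h.measurable_grad.comp hsm).const_smul c
  -- Truncated dilations are `C^1` with compact support in `Ω`; the claim follows as `ε → 0` by
  -- dominated convergence.
  have heq : ∀ ε > 0, ∫ z in Ω, grushinForm γ z (D z) (truncIdDeriv ε (v (c • z)) • c • D (c • z))
      = ∫ z in Ω, v z ^ p * truncId ε (v (c • z)) := by
    intro ε hε
    have hsub := (h.tsupport_truncId_smul_subset hε c).trans hc
    have hcs : HasCompactSupport fun z => truncId ε (v (c • z)) :=
      hb.isCompact_closure.of_isClosed_subset (isClosed_tsupport _) (hsub.trans subset_closure)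
    rw [← h.weak_eq_contDiff_one hb hγ hp hw (h.contDiff_truncId_smul hε c) hcs hsub]
    refine integral_congr_ae (Eventually.of_forall fun z => ?_)
    simp only
    rw [(h.hasGradientAt_truncId_smul hε c z).gradient]
  have lim1 : Tendsto (fun ε => ∫ z in Ω, grushinForm γ z (D z)
      (truncIdDeriv ε (v (c • z)) • c • D (c • z))) (𝓝[>] 0)
      (𝓝 (∫ z in Ω, grushinForm γ z (D z) (c • D (c • z)))) := by
    refine tendsto_integral_filter_of_dominated_convergence
      (fun _ => (1 + R) * (M * (|c| * M))) ?_ ?_ ?_ ?_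
    · filter_upwards [self_mem_nhdsWithin] with ε hε
      exact (h.measurable_grad.grushinForm hγ (((continuous_truncIdDeriv hε).measurable.comp
        (h.continuous.measurable.comp hsm)).smul hDc)).aestronglyMeasurable
    · filter_upwards [self_mem_nhdsWithin] with ε hε
      rw [ae_restrict_iff' h.isOpen.measurableSet]
      refine Eventually.of_forall fun z hz => (abs_grushinForm_le _ _ _).trans ?_
      have h1 : ‖truncIdDeriv ε (v (c • z)) • c • D (c • z)‖ ≤ 1 * (|c| * M) := by
        rw [norm_smul, norm_smul, Real.norm_eq_abs, Real.norm_eq_abs]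
        have := abs_truncIdDeriv_le hε (v (c • z))
        have := h.norm_le (c • z)
        gcongr
      rw [one_mul] at h1
      have hD := h.norm_le z
      have hRz := hR z hz
      have h4 := grushinWeight_nonneg (γ := γ) z
      gcongr
    · exact integrableOn_const hfin.ne
    · refine Eventually.of_forall fun z => ((continuous_grushinForm_right z (D z)).tendsto
        (c • D (c • z))).comp ?_
      -- Inside, `v (c • z) > 0` makes the factor tend to 1; outside, the gradient is zero by
      -- convention, whatever the factor does.
      by_cases hz : c • z ∈ Ω
      · have := (tendsto_truncIdDeriv (h.pos _ hz)).smul_const (c • D (c • z))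
        rwa [one_smul] at this
      · simp [h.grad_eq_zero _ hz]
  have lim2 : Tendsto (fun ε => ∫ z in Ω, v z ^ p * truncId ε (v (c • z))) (𝓝[>] 0)
      (𝓝 (∫ z in Ω, v z ^ p * v (c • z))) := by
    refine tendsto_integral_filter_of_dominated_convergence (fun _ => A ^ p * A) ?_ ?_ ?_ ?_
    · filter_upwards [self_mem_nhdsWithin] with ε hε
      exact ((h.continuous.rpow_const fun _ => Or.inr hp).mul ((continuous_truncId hε).comp
        (h.continuous.comp (continuous_const_smul c)))).aestronglyMeasurable
    · filter_upwards [self_mem_nhdsWithin] with ε hε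
      refine Eventually.of_forall fun z => ?_
      rw [norm_mul, Real.norm_of_nonneg (Real.rpow_nonneg (h.nonneg z) p),
        Real.norm_of_nonneg (truncId_nonneg hε _)]
      have h1 := Real.rpow_le_rpow (h.nonneg z) (hA z) hp
      have h2 := (truncId_le hε (h.nonneg (c • z))).trans (hA _)
      have h3 := truncId_nonneg hε (v (c • z))
      have h5 : 0 ≤ A ^ p := by positivity
      gcongr
    · exact integrableOn_const hfin.ne
    · exact Eventually.of_forall fun z => (tendsto_truncId (h.nonneg (c • z))).const_mul _
  refine tendsto_nhds_unique lim1 (lim2.congr' ?_)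
  filter_upwards [self_mem_nhdsWithin] with ε hε using (heq ε hε).symm

end WeakEquation

/-! ### Energy under dilation and the Pohozaev inequality -/

/-- A second order Taylor bound for `s ↦ s ^ b / b`, `b ≥ 2`, on `[0, A]`. -/
theorem rpow_div_sub_le {b A a c : ℝ} (hb : 2 ≤ b) (ha : 0 ≤ a) (haA : a ≤ A) (hc : 0 ≤ c)
    (hcA : c ≤ A) :
    c ^ b / b - a ^ b / b - a ^ (b - 1) * (c - a) ≤ (b - 1) * A ^ (b - 2) * (c - a) ^ 2 := by
  have hA : 0 ≤ A := ha.trans haA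
  have hL : 0 ≤ (b - 1) * A ^ (b - 2) := mul_nonneg (by linarith) (Real.rpow_nonneg hA _)
  -- Here `b ≥ 2` matters: it keeps `s ^ (b - 2)` bounded by its value at `A` down to `s = 0`.
  have hlip : ∀ s ∈ Icc 0 A, ∀ t ∈ Icc 0 A,
      ‖t ^ (b - 1) - s ^ (b - 1)‖ ≤ (b - 1) * A ^ (b - 2) * ‖t - s‖ := by
    intro s hs t ht
    refine Convex.norm_image_sub_le_of_norm_hasDerivWithin_le (s := Icc 0 A)
      (f := fun x : ℝ => x ^ (b - 1)) (f' := fun x => (b - 1) * x ^ (b - 2)) (fun x _ => ?_)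
      (fun x hx => ?_) (convex_Icc 0 A) hs ht
    · have := (Real.hasDerivAt_rpow_const (x := x) (p := b - 1)
        (Or.inr (by linarith))).hasDerivWithinAt (s := Icc 0 A)
      rwa [show b - 1 - 1 = b - 2 by ring] at this
    · have h1 : x ^ (b - 2) ≤ A ^ (b - 2) := Real.rpow_le_rpow hx.1 hx.2 (by linarith)
      rw [Real.norm_of_nonneg (mul_nonneg (by linarith) (Real.rpow_nonneg hx.1 _))]
      exact mul_le_mul_of_nonneg_left h1 (by linarith)
  have hseg : uIcc a c ⊆ Icc 0 A := fun s hs =>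
    ⟨(le_min ha hc).trans hs.1, hs.2.trans (max_le haA hcA)⟩
  have key := Convex.norm_image_sub_le_of_norm_hasDerivWithin_le (s := uIcc a c)
    (f := fun x : ℝ => x ^ b / b - a ^ (b - 1) * x) (f' := fun x => x ^ (b - 1) - a ^ (b - 1))
    (C := (b - 1) * A ^ (b - 2) * ‖c - a‖) (fun x _ => ?_) (fun x hx => ?_) (convex_uIcc a c)
    left_mem_uIcc right_mem_uIcc
  · have h1 := (le_abs_self _).trans key
    have h2 : ‖c - a‖ * ‖c - a‖ = (c - a) ^ 2 := by
      rw [Real.norm_eq_abs, abs_mul_abs_self, sq]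
    calc _ = c ^ b / b - a ^ (b - 1) * c - (a ^ b / b - a ^ (b - 1) * a) := by ring
      _ ≤ _ := h1
      _ = _ := by rw [mul_assoc, h2]
  · have h1 := ((Real.hasDerivAt_rpow_const (x := x) (p := b) (Or.inr (by linarith))).div_const
      b).sub ((hasDerivAt_id x).const_mul (a ^ (b - 1)))
    refine (h1.congr_deriv ?_).hasDerivWithinAt
    have : b ≠ 0 := by linarith
    field_simp
  · refine (hlip a ⟨ha, haA⟩ x (hseg hx)).trans ?_
    refine mul_le_mul_of_nonneg_left ?_ hL
    rw [Real.norm_eq_abs, Real.norm_eq_abs]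
    exact abs_sub_left_of_mem_uIcc hx

section Energy

variable {N l : ℕ} {γ b : ℝ} {Ω : Set (GSpace N l)} {v : GSpace N l → ℝ}
  {D : GSpace N l → GSpace N l} {M : ℝ}

theorem finrank_gSpace : Module.finrank ℝ (GSpace N l) = N + l := by
  rw [finrank_euclideanSpace, Fintype.card_sum, Fintype.card_fin, Fintype.card_fin]

/-- Both integrands vanish off `Ω`, so both integrals are over the whole space, where the change of
variables is exact. -/
theorem setIntegral_comp_smul_of_subset {f : GSpace N l → ℝ} (hf : ∀ z ∉ Ω, f z = 0) {c : ℝ}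
    (hc0 : 0 < c) (hc : (c • ·) ⁻¹' Ω ⊆ Ω) :
    ∫ z in Ω, f (c • z) = c ^ (-((N : ℝ) + l)) * ∫ z in Ω, f z := by
  rw [setIntegral_eq_integral_of_forall_compl_eq_zero (s := Ω) (f := f) hf,
    setIntegral_eq_integral_of_forall_compl_eq_zero (s := Ω) (f := fun z => f (c • z))
      (fun z hz => hf _ fun hcz => hz (hc hcz)),
    Measure.integral_comp_smul, finrank_gSpace, abs_of_nonneg (by positivity), smul_eq_mul,
    Real.rpow_neg hc0.le]
  norm_cast

/-- The energy `∫ |∇_x u|²`. -/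
def energyX (Ω : Set (GSpace N l)) (D : GSpace N l → GSpace N l) : ℝ :=
  ∫ z in Ω, ‖xPart (D z)‖ ^ 2

/-- The energy `∫ |x|^(2γ) |∇_y u|²`. -/
def energyY (γ : ℝ) (Ω : Set (GSpace N l)) (D : GSpace N l → GSpace N l) : ℝ :=
  ∫ z in Ω, grushinWeight γ z * ‖yPart (D z)‖ ^ 2

theorem energyY_nonneg : 0 ≤ energyY γ Ω D :=
  integral_nonneg fun z => mul_nonneg (grushinWeight_nonneg z) (sq_nonneg _)

theorem IsZeroExtension.integrableOn_energyX (h : IsZeroExtension Ω v D M)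
    (hb : Bornology.IsBounded Ω) {A : GSpace N l → GSpace N l} (hA : Measurable A) {a : ℝ}
    (ha : ∀ z, ‖A z‖ ≤ a) : IntegrableOn (fun z => ‖xPart (A z)‖ ^ 2) Ω := by
  refine integrableOn_of_measurable_of_bound hb h.isOpen (C := a ^ 2)
    ((continuous_xPart.measurable.comp hA).norm.pow_const 2) fun z _ => ?_
  rw [abs_of_nonneg (sq_nonneg _)]
  have := (norm_xPart_le (A z)).trans (ha z)
  gcongr

theorem IsZeroExtension.integrableOn_energyY (h : IsZeroExtension Ω v D M)
    (hb : Bornology.IsBounded Ω) (hγ : 0 ≤ γ) {A : GSpace N l → GSpace N l} (hA : Measurable A)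
    {a : ℝ} (ha : ∀ z, ‖A z‖ ≤ a) :
    IntegrableOn (fun z => grushinWeight γ z * ‖yPart (A z)‖ ^ 2) Ω := by
  obtain ⟨R, hR0, hR⟩ := exists_grushinWeight_le hγ hb
  refine integrableOn_of_measurable_of_bound hb h.isOpen (C := R * a ^ 2)
    ((continuous_grushinWeight hγ).measurable.mul
      ((continuous_yPart.measurable.comp hA).norm.pow_const 2)) fun z hz => ?_
  have h4 := grushinWeight_nonneg (γ := γ) z
  rw [abs_of_nonneg (mul_nonneg h4 (sq_nonneg _))]
  have := (norm_yPart_le (A z)).trans (ha z)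
  have := hR z hz
  gcongr

theorem IsZeroExtension.setIntegral_grushinForm_self (h : IsZeroExtension Ω v D M)
    (hb : Bornology.IsBounded Ω) (hγ : 0 ≤ γ) :
    ∫ z in Ω, grushinForm γ z (D z) (D z) = energyX Ω D + energyY γ Ω D := by
  simp only [grushinForm_self]
  exact integral_add (h.integrableOn_energyX hb h.measurable_grad h.norm_le)
    (h.integrableOn_energyY hb hγ h.measurable_grad h.norm_le)

/-- The chain rule gives `c ^ 2`, the volume gives `c ^ (-n)`, and the homogeneity of the weight
gives the extra `c ^ (-2γ)` of the `y` part. -/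
theorem IsZeroExtension.setIntegral_grushinForm_smul (h : IsZeroExtension Ω v D M)
    (hb : Bornology.IsBounded Ω) (hγ : 0 ≤ γ) {c : ℝ} (hc0 : 0 < c) (hc : (c • ·) ⁻¹' Ω ⊆ Ω) :
    ∫ z in Ω, grushinForm γ z (c • D (c • z)) (c • D (c • z))
      = c ^ (2 - ((N : ℝ) + l)) * energyX Ω D
        + c ^ (2 - ((N : ℝ) + l) - 2 * γ) * energyY γ Ω D := by
  have hD : Measurable fun z => c • D (c • z) :=
    (h.measurable_grad.comp (measurable_const_smul c)).const_smul c
  have hDn : ∀ z, ‖c • D (c • z)‖ ≤ c * M := fun z => by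
    rw [norm_smul, Real.norm_of_nonneg hc0.le]
    exact mul_le_mul_of_nonneg_left (h.norm_le _) hc0.le
  simp only [grushinForm_self]
  rw [integral_add (h.integrableOn_energyX hb hD hDn) (h.integrableOn_energyY hb hγ hD hDn)]
  congr 1
  · have h1 : ∀ z, ‖xPart (c • D (c • z))‖ ^ 2 = c ^ 2 * ‖xPart (D (c • z))‖ ^ 2 := fun z => by
      rw [xPart_smul, norm_smul, Real.norm_of_nonneg hc0.le, mul_pow]
    simp only [h1]
    rw [integral_const_mul, setIntegral_comp_smul_of_subset
      (f := fun z => ‖xPart (D z)‖ ^ 2) (fun z hz => by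
        simp [h.grad_eq_zero z hz, xPart, EuclideanSpace.norm_eq]) hc0 hc,
      ← mul_assoc, energyX, ← Real.rpow_natCast c 2, ← Real.rpow_add hc0]
    rfl
  · have h1 : ∀ z, grushinWeight γ z * ‖yPart (c • D (c • z))‖ ^ 2
        = c ^ (2 - 2 * γ) * (grushinWeight γ (c • z) * ‖yPart (D (c • z))‖ ^ 2) := fun z => by
      rw [yPart_smul, norm_smul, Real.norm_of_nonneg hc0.le, mul_pow, grushinWeight_smul hc0,
        Real.rpow_sub hc0]
      have : c ^ (2 * γ) ≠ 0 := (Real.rpow_pos_of_pos hc0 _).ne'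
      field_simp
      norm_cast
      ring
    simp only [h1]
    rw [integral_const_mul, setIntegral_comp_smul_of_subset
      (f := fun z => grushinWeight γ z * ‖yPart (D z)‖ ^ 2) (fun z hz => by
        simp [h.grad_eq_zero z hz, yPart, EuclideanSpace.norm_eq]) hc0 hc,
      ← mul_assoc, energyY, ← Real.rpow_add hc0]
    congr 2
    ring

/-- The energy of the difference between a solution and its rescaling. -/
theorem IsZeroExtension.exists_setIntegral_sub_le (h : IsZeroExtension Ω v D M)
    (hb : Bornology.IsBounded Ω) (hγ : 0 ≤ γ) (hb2 : 2 ≤ b)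
    (hstar : ∀ c : ℝ, 1 ≤ c → (c • ·) ⁻¹' Ω ⊆ Ω)
    (hw : ∀ φ : GSpace N l → ℝ, ContDiff ℝ ∞ φ → HasCompactSupport φ → tsupport φ ⊆ Ω →
      ∫ z in Ω, grushinForm γ z (D z) (gradient φ z) = ∫ z in Ω, v z ^ (b - 1) * φ z) :
    ∃ C : ℝ, ∀ c : ℝ, 1 ≤ c →
      ∫ z in Ω, grushinForm γ z (D z - c • D (c • z)) (D z - c • D (c • z)) ≤
        c ^ (2 - ((N : ℝ) + l)) * energyX Ω D
        + c ^ (2 - ((N : ℝ) + l) - 2 * γ) * energyY γ Ω D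
        - (1 - 2 / b) * (energyX Ω D + energyY γ Ω D)
        - 2 / b * (c ^ (-((N : ℝ) + l)) * (energyX Ω D + energyY γ Ω D))
        + C * (c - 1) ^ 2 := by
  obtain ⟨A, hA0, hA⟩ := h.exists_bound hb
  obtain ⟨r, hr⟩ := hb.exists_norm_le
  have hfin : volume Ω < ⊤ := hb.measure_lt_top
  have hb0 : 0 < b := by linarith
  have hp : 0 ≤ b - 1 := by linarith
  set L : ℝ := (b - 1) * A ^ (b - 2) with hL
  have hL0 : 0 ≤ L := mul_nonneg hp (by positivity)
  -- The weak equation tested against the solution itself (`c = 1`).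
  have hI : ∫ z in Ω, v z ^ b = energyX Ω D + energyY γ Ω D := by
    have h1 := h.weak_eq_smul hb hγ hp hw (hstar 1 le_rfl)
    simp only [one_smul] at h1
    rw [← h.setIntegral_grushinForm_self hb hγ, h1]
    refine setIntegral_congr_fun h.isOpen.measurableSet fun z hz => ?_
    rw [← Real.rpow_add_one (h.pos z hz).ne', sub_add_cancel]
  -- `L` bounds the Taylor remainder, and `|v (c z) - v z| ≤ M r (c - 1)`; the factor 2 is that of
  -- the cross term.
  refine ⟨2 * (L * (M * r) ^ 2 * volume.real Ω), fun c hc => ?_⟩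
  have hc0 : 0 < c := by linarith
  have hD : Measurable fun z => c • D (c • z) :=
    (h.measurable_grad.comp (measurable_const_smul c)).const_smul c
  have hDn : ∀ z, ‖c • D (c • z)‖ ≤ c * M := fun z => by
    rw [norm_smul, Real.norm_of_nonneg hc0.le]
    exact mul_le_mul_of_nonneg_left (h.norm_le _) hc0.le
  have i1 := integrableOn_grushinForm hγ hb h.isOpen h.measurable_grad h.measurable_grad
    h.norm_le h.norm_le
  have i2 := integrableOn_grushinForm hγ hb h.isOpen h.measurable_grad hD h.norm_le hDn
  have i3 := integrableOn_grushinForm hγ hb h.isOpen hD hD hDn hDn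
  have e1 : ∫ z in Ω, grushinForm γ z (D z - c • D (c • z)) (D z - c • D (c • z))
      = energyX Ω D + energyY γ Ω D - 2 * (∫ z in Ω, v z ^ (b - 1) * v (c • z))
        + (c ^ (2 - ((N : ℝ) + l)) * energyX Ω D
        + c ^ (2 - ((N : ℝ) + l) - 2 * γ) * energyY γ Ω D) := by
    have i12 : IntegrableOn (fun z => grushinForm γ z (D z) (D z)
        - 2 * grushinForm γ z (D z) (c • D (c • z))) Ω := i1.sub (i2.const_mul 2)
    simp only [grushinForm_sub_self]
    rw [integral_add i12 i3, integral_sub i1 (i2.const_mul 2),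
      integral_const_mul, h.setIntegral_grushinForm_self hb hγ,
      h.setIntegral_grushinForm_smul hb hγ hc0 (hstar c hc),
      h.weak_eq_smul hb hγ hp hw (hstar c hc)]
  have ib : IntegrableOn (fun z => v z ^ b) Ω :=
    ((h.continuous.rpow_const fun _ => Or.inr hb0.le).continuousOn.integrableOn_compact
      hb.isCompact_closure).mono_set subset_closure
  have ibc : IntegrableOn (fun z => v (c • z) ^ b) Ω :=
    (((h.continuous.comp (continuous_const_smul c)).rpow_const
      fun _ => Or.inr hb0.le).continuousOn.integrableOn_compact
      hb.isCompact_closure).mono_set subset_closure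
  have im := h.integrableOn_rpow_mul hb hp (h.continuous.comp (continuous_const_smul c))
  have e2 : 1 / b * (∫ z in Ω, v (c • z) ^ b) + (1 - 1 / b) * (∫ z in Ω, v z ^ b)
      - L * (M * r) ^ 2 * (c - 1) ^ 2 * volume.real Ω ≤ ∫ z in Ω, v z ^ (b - 1) * v (c • z) := by
    have hconst : ∫ z in Ω, L * (M * r) ^ 2 * (c - 1) ^ 2
        = L * (M * r) ^ 2 * (c - 1) ^ 2 * volume.real Ω := by
      rw [setIntegral_const, smul_eq_mul, mul_comm]
    have ibb : IntegrableOn (fun z => 1 / b * v (c • z) ^ b + (1 - 1 / b) * v z ^ b) Ω :=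
      (ibc.const_mul _).add (ib.const_mul _)
    rw [← hconst, ← integral_const_mul, ← integral_const_mul,
      ← integral_add (ibc.const_mul _) (ib.const_mul _),
      ← integral_sub ibb (integrableOn_const hfin.ne)]
    refine setIntegral_mono_on (ibb.sub (integrableOn_const hfin.ne)) im h.isOpen.measurableSet fun z hz => ?_
    have h1 := rpow_div_sub_le hb2 (h.nonneg z) (hA z) (h.nonneg (c • z)) (hA _)
    rw [← hL] at h1
    have h2 : (v (c • z) - v z) ^ 2 ≤ (M * r) ^ 2 * (c - 1) ^ 2 := by
      have h3 := h.abs_sub_le (c • z) z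
      have h4 : ‖c • z - z‖ ≤ (c - 1) * r := by
        have : c • z - z = (c - 1) • z := by rw [sub_smul, one_smul]
        rw [this, norm_smul, Real.norm_of_nonneg (by linarith)]
        exact mul_le_mul_of_nonneg_left (hr z hz) (by linarith)
      have h5 := h3.trans (mul_le_mul_of_nonneg_left h4 h.bound_nonneg)
      rw [← sq_abs, ← mul_pow]
      refine pow_le_pow_left₀ (abs_nonneg _) (h5.trans (le_of_eq (by ring))) 2
    have h3 := mul_le_mul_of_nonneg_left h2 hL0
    have h4 : v z ^ (b - 1) * v z = v z ^ b := by
      rw [← Real.rpow_add_one (h.pos z hz).ne', sub_add_cancel]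
    linear_combination h1 + h3 - h4
  rw [setIntegral_comp_smul_of_subset (f := fun z => v z ^ b) (fun z hz => by
    rw [h.eq_zero z hz, Real.zero_rpow hb0.ne']) hc0 (hstar c hc), hI] at e2
  rw [e1]
  linear_combination 2 * e2

/-- At the exponent `b = 2n/(n-2)` the energy of the difference between a solution and its
rescaling is small to first order, and the weighted energy in `y` vanishes unless `γ = 0`. -/
theorem IsZeroExtension.pohozaev (h : IsZeroExtension Ω v D M)
    (hb : Bornology.IsBounded Ω) (hγ : 0 ≤ γ) (hNl : 3 ≤ N + l)
    (hstar : ∀ c : ℝ, 1 ≤ c → (c • ·) ⁻¹' Ω ⊆ Ω)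
    (hw : ∀ φ : GSpace N l → ℝ, ContDiff ℝ ∞ φ → HasCompactSupport φ → tsupport φ ⊆ Ω →
      ∫ z in Ω, grushinForm γ z (D z) (gradient φ z)
        = ∫ z in Ω, v z ^ (2 * ((N : ℝ) + l) / ((N : ℝ) + l - 2) - 1) * φ z) :
    γ * energyY γ Ω D = 0 ∧ ∀ η > 0, ∀ᶠ c in 𝓝[>] (1 : ℝ),
      ∫ z in Ω, grushinForm γ z (D z - c • D (c • z)) (D z - c • D (c • z)) ≤ η * (c - 1) := by
  set n : ℝ := (N : ℝ) + l with hn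
  have hn3 : 3 ≤ n := by rw [hn]; exact_mod_cast hNl
  have hn2 : 0 < n - 2 := by linarith
  have hb2 : 2 ≤ 2 * n / (n - 2) := by rw [le_div_iff₀ hn2]; linarith
  obtain ⟨C, hC⟩ := h.exists_setIntegral_sub_le hb hγ hb2 hstar hw
  have hbn : 2 / (2 * n / (n - 2)) = (n - 2) / n := by field_simp
  rw [hbn, ← hn] at hC
  set X := energyX Ω D
  set Y := energyY γ Ω D with hY
  let f : ℝ → ℝ := fun c => c ^ (2 - n) * X + c ^ (2 - n - 2 * γ) * Y
    - (1 - (n - 2) / n) * (X + Y) - (n - 2) / n * (c ^ (-n) * (X + Y)) + C * (c - 1) ^ 2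
  have hf1 : f 1 = 0 := by simp [f]; ring
  have hrp : ∀ q : ℝ, HasDerivAt (fun c : ℝ => c ^ q) q 1 := fun q => by
    have := Real.hasDerivAt_rpow_const (x := 1) (p := q) (Or.inl one_ne_zero)
    simpa using this
  -- The exponent is critical: `X` gets the coefficient `(2 - n) + (n - 2) = 0`, and `Y` keeps only
  -- `-2γ`.
  have hfd : HasDerivAt f (-(2 * (γ * Y))) 1 := by
    have h1 : HasDerivAt f ((2 - n) * X + (2 - n - 2 * γ) * Y - (n - 2) / n * (-n * (X + Y))
        + C * (2 * (1 - 1) ^ 1 * 1)) 1 :=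
      ((((hrp _).mul_const X).add ((hrp _).mul_const Y)).sub_const _).sub
        (((hrp _).mul_const (X + Y)).const_mul _) |>.add
        ((((hasDerivAt_id (1 : ℝ)).sub_const 1).pow 2).const_mul C)
    refine h1.congr_deriv ?_
    field_simp
    ring
  have hs := (hasDerivAt_iff_tendsto_slope.1 hfd).mono_left
    (nhdsWithin_mono 1 (fun s hs => (ne_of_gt (mem_Ioi.1 hs)) : Ioi (1 : ℝ) ⊆ {1}ᶜ))
  have hle : ∀ c : ℝ, 1 < c →
      ∫ z in Ω, grushinForm γ z (D z - c • D (c • z)) (D z - c • D (c • z))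
        ≤ slope f 1 c * (c - 1) := fun c hc => by
    rw [slope_def_field, hf1, sub_zero, div_mul_cancel₀ _ (sub_pos.2 hc).ne']
    exact hC c hc.le
  have hnn : ∀ c : ℝ, 0 ≤ ∫ z in Ω, grushinForm γ z (D z - c • D (c • z)) (D z - c • D (c • z)) :=
    fun c => integral_nonneg fun z => grushinForm_self_nonneg _ _
  have hYn : 0 ≤ γ * Y := mul_nonneg hγ energyY_nonneg
  have h0 : γ * Y = 0 := by
    have : 0 ≤ -(2 * (γ * Y)) := by
      refine ge_of_tendsto hs ?_
      filter_upwards [self_mem_nhdsWithin] with c hc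
      exact nonneg_of_mul_nonneg_left ((hnn c).trans (hle c hc)) (sub_pos.2 hc)
    linarith
  refine ⟨h0, fun η hη => ?_⟩
  rw [h0, mul_zero, neg_zero] at hs
  filter_upwards [hs.eventually (Iio_mem_nhds hη), self_mem_nhdsWithin] with c hc hc1
  exact (hle c hc1).trans (mul_le_mul_of_nonneg_right (le_of_lt hc) (sub_pos.2 hc1).le)

/-- A solution has positive energy. -/
theorem IsZeroExtension.energy_pos (h : IsZeroExtension Ω v D M)
    (hb : Bornology.IsBounded Ω) (hne : Ω.Nonempty) (hγ : 0 ≤ γ) (hb1 : 1 ≤ b)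
    (hw : ∀ φ : GSpace N l → ℝ, ContDiff ℝ ∞ φ → HasCompactSupport φ → tsupport φ ⊆ Ω →
      ∫ z in Ω, grushinForm γ z (D z) (gradient φ z) = ∫ z in Ω, v z ^ (b - 1) * φ z) :
    0 < energyX Ω D + energyY γ Ω D := by
  have hp : 0 ≤ b - 1 := by linarith
  have h1 := h.weak_eq_smul (c := 1) hb hγ hp hw (by simp)
  simp only [one_smul] at h1
  rw [← h.setIntegral_grushinForm_self hb hγ, h1]
  have hpos : ∀ z ∈ Ω, 0 < v z ^ (b - 1) * v z := fun z hz =>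
    mul_pos (Real.rpow_pos_of_pos (h.pos z hz) _) (h.pos z hz)
  rw [setIntegral_pos_iff_support_of_nonneg_ae
    ((ae_restrict_iff' h.isOpen.measurableSet).2 (Eventually.of_forall fun z hz => (hpos z hz).le))
    (h.integrableOn_rpow_mul hb hp h.continuous)]
  have hsub : Ω ⊆ Function.support fun z => v z ^ (b - 1) * v z := fun z hz => (hpos z hz).ne'
  rw [inter_eq_self_of_subset_right hsub]
  exact h.isOpen.measure_pos volume hne

end Energy

/-! ### The case of a genuine weight -/

section Degenerate

variable {N l : ℕ} {γ : ℝ} {Ω : Set (GSpace N l)} {v : GSpace N l → ℝ}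
  {D : GSpace N l → GSpace N l} {M : ℝ}

theorem ae_xPart_ne_zero (hN : 0 < N) : ∀ᵐ z : GSpace N l, xPart z ≠ 0 := by
  let L : GSpace N l →ₗ[ℝ] ℝ := (EuclideanSpace.proj (Sum.inl ⟨0, hN⟩) : GSpace N l →L[ℝ] ℝ)
  have hL : LinearMap.ker L ≠ ⊤ := by
    rw [Ne, LinearMap.ker_eq_top]
    intro h
    have := LinearMap.congr_fun h (EuclideanSpace.single (Sum.inl ⟨0, hN⟩) (1 : ℝ))
    simp [L] at this
  have h0 := Measure.addHaar_submodule volume _ hL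
  rw [ae_iff]
  refine measure_mono_null (fun z hz => ?_) h0
  have hz0 : xPart z = 0 := by simpa using hz
  have := congrArg (fun w : EuclideanSpace ℝ (Fin N) => w ⟨0, hN⟩) hz0
  simpa [L, xPart] using this

/-- The weight vanishes at most on the null set `x = 0`, so the gradient in `y` is zero almost
everywhere in `Ω`, and everywhere by continuity. -/
theorem IsZeroExtension.yPart_grad_eq_zero (h : IsZeroExtension Ω v D M)
    (hb : Bornology.IsBounded Ω) (hγ : 0 ≤ γ) (hN : 0 < N) (hY : energyY γ Ω D = 0)
    (z : GSpace N l) : yPart (D z) = 0 := by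
  by_cases hz : z ∈ Ω
  · have h1 := (setIntegral_eq_zero_iff_of_nonneg_ae
      (Eventually.of_forall fun z => mul_nonneg (grushinWeight_nonneg z) (sq_nonneg _))
      (h.integrableOn_energyY hb hγ h.measurable_grad h.norm_le)).1 hY
    have h2 : (fun z => yPart (D z)) =ᵐ[volume.restrict Ω] fun _ => 0 := by
      filter_upwards [h1, ae_restrict_of_ae (ae_xPart_ne_zero hN)] with w hw hx
      have hω : grushinWeight γ w ≠ 0 :=
        (pow_pos (Real.rpow_pos_of_pos (norm_pos_iff.2 hx) _) 2).ne'
      rcases mul_eq_zero.1 hw with h3 | h3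
      · exact absurd h3 hω
      · exact norm_eq_zero.1 (pow_eq_zero_iff two_ne_zero |>.1 h3)
    exact Measure.eqOn_open_of_ae_eq h2 h.isOpen
      (continuous_yPart.comp_continuousOn h.continuousOn) continuousOn_const hz
  · ext j
    simp [yPart, h.grad_eq_zero z hz]

/-- A positive function in a bounded set, vanishing off it, depends on `y`. -/
theorem IsZeroExtension.exists_yPart_grad_ne_zero (h : IsZeroExtension Ω v D M)
    (hb : Bornology.IsBounded Ω) (hne : Ω.Nonempty) (hl : 0 < l) : ∃ z, yPart (D z) ≠ 0 := by
  by_contra! hD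
  obtain ⟨z, hz⟩ := hne
  obtain ⟨r, hr⟩ := hb.exists_norm_le
  let e : GSpace N l := EuclideanSpace.single (Sum.inr ⟨0, hl⟩) 1
  have he : ‖e‖ = 1 := by simp [e]
  have hDe : ∀ w, ⟪D w, e⟫_ℝ = 0 := fun w => by
    have := congrArg (fun y : EuclideanSpace ℝ (Fin l) => y ⟨0, hl⟩) (hD w)
    simpa [e, yPart, EuclideanSpace.inner_single_right] using this
  have hout : z + (r + ‖z‖ + 1) • e ∉ Ω := fun hmem => by
    have h1 := hr _ hmem
    have h2 : ‖(r + ‖z‖ + 1) • e‖ ≤ ‖z + (r + ‖z‖ + 1) • e‖ + ‖z‖ := by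
      simpa using norm_sub_le (z + (r + ‖z‖ + 1) • e) z
    rw [norm_smul, he, mul_one] at h2
    have := le_abs_self (r + ‖z‖ + 1)
    rw [Real.norm_eq_abs] at h2
    linarith
  -- The truncation is differentiable along the entire line, also where the line leaves `Ω`, so it
  -- equals its value at a far point.
  have hconst : ∀ ε > 0, truncId ε (v z) = 0 := by
    intro ε hε
    have hder : ∀ t : ℝ, HasDerivAt (fun t : ℝ => truncId ε (v (z + t • e))) 0 t := fun t => by
      have h1 : HasDerivAt (fun t : ℝ => z + t • e) ((1 : ℝ) • e) t :=
        ((hasDerivAt_id t).smul_const e).const_add z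
      have h2 := (h.hasGradientAt_truncId hε (z + t • e)).hasFDerivAt.comp_hasDerivAt t h1
      refine h2.congr_deriv ?_
      simp [hDe]
    have h1 := is_const_of_deriv_eq_zero (fun t => (hder t).differentiableAt)
      (fun t => (hder t).deriv) 0 (r + ‖z‖ + 1)
    simp only [zero_smul, add_zero] at h1
    rw [h1, h.eq_zero _ hout]
    exact truncId_of_le hε hε.le
  have hlim := tendsto_truncId (h.nonneg z)
  have h0 : v z = 0 := by
    refine tendsto_nhds_unique hlim (tendsto_const_nhds.congr' ?_)
    filter_upwards [self_mem_nhdsWithin] with ε hε using (hconst ε hε).symm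
  exact (h.pos z hz).ne' h0

end Degenerate

/-! ### Boundary layers swept by dilations -/

section Boundary

variable {N l : ℕ} {Ω : Set (GSpace N l)}

/-- If few points of `Ω` near `z₀` leave `Ω` under dilations `c` close to `1`, then none leave the
closure. -/
theorem exists_nhds_smul_mem_closure (hΩ : IsOpen Ω) (hb : Bornology.IsBounded Ω)
    {z₀ : GSpace N l} {W : Set (GSpace N l)}
    (hW : W ∈ 𝓝 z₀)
    (hsmall : ∀ η > 0, ∀ᶠ c in 𝓝[>] (1 : ℝ),
      volume.real {z ∈ Ω ∩ W | c • z ∉ Ω} ≤ η * (c - 1)) :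
    ∃ O ∈ 𝓝 z₀, ∀ᶠ c in 𝓝[>] (1 : ℝ), ∀ z ∈ Ω ∩ O, c • z ∈ closure Ω := by
  have hcont : Tendsto (fun q : ℝ × GSpace N l => q.1 • q.2) (𝓝 (1, z₀)) (𝓝 z₀) := by
    have : Tendsto (fun q : ℝ × GSpace N l => q.1 • q.2) (𝓝 (1, z₀)) (𝓝 ((1 : ℝ) • z₀)) :=
      continuous_smul.tendsto (1, z₀)
    rwa [one_smul] at this
  obtain ⟨δ, hδ, hδW⟩ := Metric.mem_nhds_iff.1 (hcont hW)
  have hmemW : ∀ c : ℝ, 1 ≤ c → c < 1 + δ → ∀ z ∈ ball z₀ δ, c • z ∈ W := fun c hc hcδ z hz => by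
    have : (c, z) ∈ ball ((1 : ℝ), z₀) δ := by
      rw [← ball_prod_same]
      refine ⟨?_, hz⟩
      rw [mem_ball, Real.dist_eq, abs_of_nonneg (by linarith)]
      linarith
    exact hδW this
  have hfin : ∀ s ⊆ Ω, volume s ≠ ⊤ := fun s hs => ((measure_mono hs).trans_lt hb.measure_lt_top).ne
  refine ⟨ball z₀ δ, ball_mem_nhds _ hδ, ?_⟩
  filter_upwards [Ioo_mem_nhdsGT (show (1 : ℝ) < 1 + δ by linarith)] with Λ hΛ
  have hΛ0 : 0 < Λ - 1 := sub_pos.2 hΛ.1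
  let S : Set (GSpace N l) := {z ∈ Ω ∩ ball z₀ δ | Λ • z ∉ Ω}
  have hSfin : volume S ≠ ⊤ := hfin S fun z hz => hz.1.1
  have hbound : ∀ η > 0, volume.real S ≤ η * (Λ - 1) := by
    intro η hη
    obtain ⟨c₁, hc₁, hc₁s⟩ := mem_nhdsGT_iff_exists_Ioo_subset.1 (hsmall η hη)
    have hc₁0 : 0 < c₁ - 1 := sub_pos.2 hc₁
    obtain ⟨k, hk⟩ := exists_nat_gt ((Λ - 1) / (c₁ - 1))
    have hk0 : 0 < (k : ℝ) := (div_pos hΛ0 hc₁0).trans hk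
    have hkn : k ≠ 0 := by rintro rfl; simp at hk0
    -- The dilation by `Λ` is split into `k` equal ones, so small that the volume hypothesis
    -- applies; Bernoulli's inequality gives `k (c - 1) ≤ Λ - 1`, so the `k` errors add up to at
    -- most `η (Λ - 1)`.
    let c : ℝ := Λ ^ ((k : ℝ)⁻¹)
    have hck : c ^ k = Λ := Real.rpow_inv_natCast_pow (by linarith [hΛ.1]) hkn
    have hc1 : 1 < c := Real.one_lt_rpow hΛ.1 (inv_pos.2 hk0)
    have hkc : k * (c - 1) ≤ Λ - 1 := by
      have := one_add_mul_sub_le_pow (a := c) (by linarith) k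
      linarith
    have hcc₁ : c < c₁ := by
      rw [div_lt_iff₀ hc₁0] at hk
      have : k * (c - 1) < k * (c₁ - 1) := hkc.trans_lt hk
      linarith [lt_of_mul_lt_mul_left this hk0.le]
    let A : Set (GSpace N l) := {z ∈ Ω ∩ W | c • z ∉ Ω}
    have hA : volume.real A ≤ η * (c - 1) := hc₁s ⟨hc1, hcc₁⟩
    have hAfin : volume A ≠ ⊤ := hfin A fun z hz => hz.1.1
    -- Along `z, c z, ..., c^k z = Λ z` there is a last point before the first exit from `Ω`; it
    -- lies in `A`, since all these points stay in `W`.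
    have hcover : S ⊆ ⋃ j ∈ Finset.range k, (c ^ j • ·) ⁻¹' A := by
      intro z hz
      by_contra hcon
      simp only [Finset.mem_range, mem_iUnion, mem_preimage, not_exists] at hcon
      have hall : ∀ j, j ≤ k → c ^ j • z ∈ Ω := by
        intro j
        induction j with
        | zero => intro _; simpa using hz.1.1
        | succ j ih =>
          intro hj
          by_contra hout
          refine hcon j hj ⟨⟨ih (by omega), hmemW _ (one_le_pow₀ hc1.le) ?_ z hz.1.2⟩, ?_⟩
          · calc c ^ j ≤ c ^ k := pow_le_pow_right₀ hc1.le (by omega)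
              _ < 1 + δ := by rw [hck]; exact hΛ.2
          · rwa [smul_smul, ← pow_succ']
      have := hall k le_rfl
      rw [hck] at this
      exact hz.2 this
    have hpre : ∀ j, volume ((c ^ j • ·) ⁻¹' A) ≤ volume A := fun j => by
      have hcj : 1 ≤ c ^ j := one_le_pow₀ hc1.le
      rw [Measure.addHaar_preimage_smul volume (by positivity)]
      refine mul_le_of_le_one_left zero_le ?_
      rw [ENNReal.ofReal_le_one, abs_of_nonneg (by positivity)]
      exact inv_le_one_of_one_le₀ (one_le_pow₀ hcj)
    have hS : volume S ≤ k * volume A := by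
      refine (measure_mono hcover).trans ((measure_biUnion_finset_le _ _).trans ?_)
      refine (Finset.sum_le_sum fun j _ => hpre j).trans (le_of_eq ?_)
      rw [Finset.sum_const, Finset.card_range, nsmul_eq_mul]
    have hS' : volume.real S ≤ k * volume.real A := by
      have := ENNReal.toReal_mono (ENNReal.mul_ne_top (ENNReal.natCast_ne_top k) hAfin) hS
      simpa [Measure.real, ENNReal.toReal_mul] using this
    calc volume.real S ≤ k * (η * (c - 1)) := hS'.trans (by gcongr)
      _ = η * (k * (c - 1)) := by ring
      _ ≤ η * (Λ - 1) := by gcongr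
  have hS0 : volume S = 0 := by
    have h1 : volume.real S ≤ 0 := by
      refine le_of_forall_pos_le_add fun ε hε => ?_
      have := hbound (ε / (Λ - 1)) (div_pos hε hΛ0)
      rwa [div_mul_cancel₀ _ hΛ0.ne', ← zero_add ε] at this
    exact (measureReal_eq_zero_iff hSfin).1 (le_antisymm h1 measureReal_nonneg)
  -- A null set need not be empty, but an open one is; openness is the reason for passing to the
  -- closure.
  have hopen : IsOpen {z ∈ Ω ∩ ball z₀ δ | Λ • z ∉ closure Ω} :=
    (hΩ.inter isOpen_ball).inter
      (isClosed_closure.isOpen_compl.preimage (continuous_const_smul Λ))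
  have hsub : {z ∈ Ω ∩ ball z₀ δ | Λ • z ∉ closure Ω} ⊆ S :=
    fun z hz => ⟨hz.1, fun hzΩ => hz.2 (subset_closure hzΩ)⟩
  have hempty := (hopen.measure_eq_zero_iff volume).1
    (measure_mono_null hsub hS0)
  intro z hz
  by_contra hout
  have hmem : z ∈ {z ∈ Ω ∩ ball z₀ δ | Λ • z ∉ closure Ω} := ⟨hz, hout⟩
  rw [hempty] at hmem
  exact hmem

/-- On the layer `D (c • z) = 0`, so the integrand is `‖D z‖ ^ 2 ≥ κ` and Chebyshev's inequality
applies. -/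
theorem IsZeroExtension.volume_leave_le {v : GSpace N l → ℝ}
    {D : GSpace N l → GSpace N l} {M : ℝ} (h : IsZeroExtension Ω v D M)
    (hb : Bornology.IsBounded Ω) {W : Set (GSpace N l)} (hW : IsOpen W) {κ : ℝ} (hκ : 0 < κ)
    (hD : ∀ z ∈ Ω ∩ W, κ ≤ ‖D z‖ ^ 2)
    (hsmall : ∀ η > 0, ∀ᶠ c in 𝓝[>] (1 : ℝ),
      ∫ z in Ω, ‖D z - c • D (c • z)‖ ^ 2 ≤ η * (c - 1)) :
    ∀ η > 0, ∀ᶠ c in 𝓝[>] (1 : ℝ), volume.real {z ∈ Ω ∩ W | c • z ∉ Ω} ≤ η * (c - 1) := by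
  intro η hη
  filter_upwards [hsmall (κ * η) (mul_pos hκ hη), self_mem_nhdsWithin] with c hc hc1
  have hc0 : 0 < c := zero_lt_one.trans hc1
  set A : Set (GSpace N l) := {z ∈ Ω ∩ W | c • z ∉ Ω} with hA
  have hAm : MeasurableSet A := (h.isOpen.inter hW).measurableSet.inter
    (h.isOpen.isClosed_compl.preimage (continuous_const_smul c)).measurableSet
  have hAΩ : A ⊆ Ω := fun z hz => hz.1.1
  have hAfin : volume A ≠ ⊤ := ((measure_mono hAΩ).trans_lt hb.measure_lt_top).ne
  have hint : IntegrableOn (fun z => ‖D z - c • D (c • z)‖ ^ 2) Ω := by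
    refine integrableOn_of_measurable_of_bound hb h.isOpen (C := (M + c * M) ^ 2)
      ((h.measurable_grad.sub ((h.measurable_grad.comp
        (measurable_const_smul c)).const_smul c)).norm.pow_const 2) fun z _ => ?_
    rw [abs_of_nonneg (sq_nonneg _)]
    have : ‖D z - c • D (c • z)‖ ≤ M + c * M := by
      refine (norm_sub_le _ _).trans (add_le_add (h.norm_le z) ?_)
      rw [norm_smul, Real.norm_of_nonneg hc0.le]
      exact mul_le_mul_of_nonneg_left (h.norm_le _) hc0.le
    gcongr
  have h1 : κ * volume.real A ≤ ∫ z in A, ‖D z - c • D (c • z)‖ ^ 2 := by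
    have : ∫ _ in A, κ = κ * volume.real A := by rw [setIntegral_const, smul_eq_mul, mul_comm]
    rw [← this]
    refine setIntegral_mono_on (integrableOn_const hAfin) (hint.mono_set hAΩ) hAm fun z hz => ?_
    rw [h.grad_eq_zero _ hz.2, smul_zero, sub_zero]
    exact hD z hz.1
  have h2 : ∫ z in A, ‖D z - c • D (c • z)‖ ^ 2 ≤ ∫ z in Ω, ‖D z - c • D (c • z)‖ ^ 2 :=
    setIntegral_mono_set hint (Eventually.of_forall fun z => sq_nonneg _) hAΩ.eventuallyLE
  have h3 := h1.trans (h2.trans hc)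
  rw [mul_assoc] at h3
  exact le_of_mul_le_mul_left h3 hκ

end Boundary

/-- For `γ = 0` the weight is 1 even at `x = 0`, as `0 ^ 0 = 1`; for `l = 0` there is no `y` part.
-/
theorem grushinForm_self_eq_norm_sq {N l : ℕ} {γ : ℝ} (h : γ = 0 ∨ l = 0) (z w : GSpace N l) :
    grushinForm γ z w w = ‖w‖ ^ 2 := by
  rw [grushinForm_self, ← norm_sq_xPart_add_norm_sq_yPart w]
  rcases h with rfl | rfl
  · simp [grushinWeight]
  · rw [Subsingleton.elim (yPart w) 0]
    simp

end

/-! ### The nonexistence theorem -/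

theorem corollary1p4 (N l : ℕ) (hNl : 3 ≤ N + l) (γ : ℝ) (hγ : 0 ≤ γ)
    (Ω : Set (GSpace N l)) (hΩ_open : IsOpen Ω) (hΩ_conn : IsConnected Ω)
    (hΩ_bdd : Bornology.IsBounded Ω) (hΩ_lip : HasLipschitzBoundary Ω)
    (hΩ_star : IsLStarshaped γ Ω) :
    ¬ ∃ u : GSpace N l → ℝ,
      IsPositiveSolution γ (2 * ((N : ℝ) + l) / ((N : ℝ) + l - 2)) Ω u ∧
      ∃ z ∈ frontier Ω, ∃ ν : GSpace N l, IsOutwardUnitNormal Ω z ν ∧ normalDeriv Ω u z ν ≠ 0 := by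
  rintro ⟨u, hu, z₀, hz₀, ν, -, hν⟩
  have huniq := hΩ_lip.uniqueDiffOn_closure hΩ_open
  obtain ⟨M, h⟩ := exists_isZeroExtension hΩ_open hΩ_bdd huniq hu.contDiffOn hu.pos hu.boundary
  have hstar : ∀ c : ℝ, 1 ≤ c → (c • ·) ⁻¹' Ω ⊆ Ω := fun c hc z hz => by
    have hc0 : 0 < c := by linarith
    have := hΩ_star.smul_mem hΩ_open hΩ_lip hz (inv_pos.2 hc0) (inv_le_one_of_one_le₀ hc)
    rwa [smul_smul, inv_mul_cancel₀ hc0.ne', one_smul] at this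
  have hw : ∀ φ : GSpace N l → ℝ, ContDiff ℝ ∞ φ → HasCompactSupport φ → tsupport φ ⊆ Ω →
      ∫ z in Ω, grushinForm γ z (Ω.indicator (gradient u) z) (gradient φ z)
        = ∫ z in Ω, Ω.indicator u z ^ (2 * ((N : ℝ) + l) / ((N : ℝ) + l - 2) - 1) * φ z := by
    intro φ h1 h2 h3
    have h4 := hu.weak_eq φ h1 h2 h3
    simp only [inner_grushinGradient] at h4
    rw [setIntegral_congr_fun hΩ_open.measurableSet (g := fun z =>
        grushinForm γ z (gradient u z) (gradient φ z)) fun z hz => by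
        simp only [Set.indicator_of_mem hz], h4]
    exact setIntegral_congr_fun hΩ_open.measurableSet fun z hz => by
        simp only [Set.indicator_of_mem hz]
  obtain ⟨hY, hsmall⟩ := h.pohozaev hΩ_bdd hγ hNl hstar hw
  by_cases hdeg : γ = 0 ∨ l = 0
  · simp only [grushinForm_self_eq_norm_sq hdeg] at hsmall
    -- Only this is needed of the normal derivative; continuity up to the boundary then bounds the
    -- gradient below near `z₀`.
    have hd0 : fderivWithin ℝ u (closure Ω) z₀ ≠ 0 := fun h0 => hν (by
      rw [normalDeriv, h0]
      rfl)
    have hcw := (hu.contDiffOn.continuousOn_fderivWithin huniq le_rfl z₀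
      (frontier_subset_closure hz₀)).norm
    have hpos : 0 < ‖fderivWithin ℝ u (closure Ω) z₀‖ := norm_pos_iff.2 hd0
    have hev := hcw.eventually (Ioi_mem_nhds (half_lt_self hpos))
    obtain ⟨W, hWo, hzW, hW⟩ := mem_nhdsWithin.1 hev
    have hD : ∀ z ∈ Ω ∩ W, (‖fderivWithin ℝ u (closure Ω) z₀‖ / 2) ^ 2
        ≤ ‖Ω.indicator (gradient u) z‖ ^ 2 := fun z hz => by
      have h1 := hW ⟨hz.2, subset_closure hz.1⟩
      rw [Set.indicator_of_mem hz.1, gradient, LinearIsometryEquiv.norm_map,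
        ← fderivWithin_of_mem_nhds (Filter.mem_of_superset (hΩ_open.mem_nhds hz.1) subset_closure)]
      exact pow_le_pow_left₀ (by positivity) (le_of_lt h1) 2
    obtain ⟨O, hO, hOc⟩ := exists_nhds_smul_mem_closure hΩ_open hΩ_bdd (hWo.mem_nhds hzW)
      (h.volume_leave_le hΩ_bdd hWo (by positivity) hD hsmall)
    obtain ⟨w, ⟨hwf, hwO⟩, hw1⟩ := exists_mem_frontier_eventually_smul_notMem_closure hΩ_lip
      hΩ_star hz₀ (interior_mem_nhds.2 hO)
    obtain ⟨c, hc1, hc2⟩ := (hw1.and hOc).exists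
    have hwcl : w ∈ closure (interior O ∩ Ω) :=
      isOpen_interior.inter_closure ⟨hwO, frontier_subset_closure hwf⟩
    have hcl : IsClosed ((c • ·) ⁻¹' closure Ω : Set (GSpace N l)) :=
      isClosed_closure.preimage (continuous_const_smul c)
    exact hc1 (closure_minimal (fun z hz => hc2 z ⟨hz.2, interior_subset hz.1⟩) hcl hwcl)
  · rw [not_or] at hdeg
    have hY0 := (mul_eq_zero.1 hY).resolve_left hdeg.1
    -- Without `x` variables the weight is identically zero and gives no information on the
    -- gradient, hence the separate argument by positive energy.
    rcases Nat.eq_zero_or_pos N with rfl | hN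
    · have hn : (1 : ℝ) ≤ 2 * (((0 : ℕ) : ℝ) + l) / (((0 : ℕ) : ℝ) + l - 2) := by
        have : (3 : ℝ) ≤ ((0 : ℕ) : ℝ) + l := by exact_mod_cast hNl
        rw [one_le_div (by linarith)]
        linarith
      have hpos := h.energy_pos hΩ_bdd hΩ_conn.nonempty hγ hn hw
      have hX : energyX Ω (Ω.indicator (gradient u)) = 0 := by
        have : ∀ z, xPart (Ω.indicator (gradient u) z) = 0 := fun z => Subsingleton.elim _ _
        simp [energyX, this]
      rw [hX, hY0] at hpos
      simp at hpos
    · obtain ⟨z, hz⟩ := h.exists_yPart_grad_ne_zero hΩ_bdd hΩ_conn.nonempty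
        (Nat.pos_of_ne_zero hdeg.2)
      exact hz (h.yPart_grad_eq_zero hΩ_bdd hγ hN hY0 z)
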